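/- **Setting.** Fix $\lambda,\tau>0$. Let $|\cdot|$ be the Euclidean (Frobenius) norm on $\mathbb R^{2\times2}$ and $\nabla^\perp\varphi=(\partial_2\varphi,-\partial_1\varphi)$. For $\Omega\subset\mathbb R^2$ open, $A\in L^1_{\rm loc}(\Omega;\mathbb R^{2\times2})$, $S\subset\Omega$ relatively closed and $\varepsilon>0$, consider: - (H1) $S\supseteq\operatorname{supp}(\operatorname{Curl}A)$ (distributional support in $\Omega$); - (H2) for every simple rectifiable closed curve $\gamma$ in $\Omega\setminus S$ that is the boundary of a bounded open set $D\subset\Omega$, $\int_\gamma A\in\tau\varepsilon\mathbb Z^2$, where, up to the sign given by the orientation of $\gamma$, $\int_\gamma A:=\int_\Omega A\,\nabla^\perp\varphi\,dx$ for any $\varphi\in C_c^\infty(\Omega)$ with $\varphi=1$ on $D$ and $(\operatorname{supp}\varphi)\setminus D\subset\Omega\setminus S$. $\mathcal C_\varepsilon(\Omega)$ is the set of pairs $(A,S)$ with $A\in L^1(\Omega;\mathbb R^{2\times2})$ satisfying (H1) and (H2). With $B_{r}(S)=\{x\in\Omega:\operatorname{dist}(x,S)<r\}$ put $$\mathcal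 F_\varepsilon(A,S;\Omega)=\int_{\Omega\setminus B_{\lambda\varepsilon}(S)}\operatorname{dist}^2(A,SO(2))\,dx+|B_{\lambda\varepsilon}(S)|,\qquad F_\varepsilon(A,\Omega)=\frac1\varepsilon\inf\{\mathcal F_\varepsilon(A,S;\Omega):(A,S)\in\mathcal C_\varepsilon(\Omega)\}.$$ Let $Q_L=(-L,L)^2$, let $I_{R^-,R^+}(x)=R^-$ if $x_1<0$ and $R^+$ if $x_1\ge0$, and let $$\psi(R^-,R^+,L)=\inf\{F_1(A,Q_L):A\in L^1_{\rm loc}(\mathbb R^2;\mathbb R^{2\times2}),\ A=I_{R^-,R^+}\text{ in }\mathbb R^2\setminus Q_{L'}\text{ for some }L'<L\},$$ $$\psi_\infty(R^-,R^+)=\limsup_{L\to\infty}\frac1{2L}\psi(R^-,R^+,L)$$ (which is the limit whenever the limit exists). **Proposition.** There is a constant $C>0$, depending only on $\lambda$ and $\tau$, such that for all $R^-,R^+\in SO(2)$ (not necessarily symmetric with respect to the interface $\{x_1=0\}$) the following holds, where $0\cdot(|\log 0|+1):=0$. 1. There are $l,h>0$ depending on $R^-,R^+$ (and $\lambda,\tau$)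 such that for every $\varepsilon>0$ there are a field $A_\varepsilon\in L^1_{\rm loc}(\mathbb R^2;\mathbb R^{2\times2})$ and a closed set $S_\varepsilon\subset\mathbb R^2$ satisfying (H1) and (H2) in $\Omega=\mathbb R^2$, with $$A_\varepsilon(x)=I_{R^-,R^+}(x)\qquad\forall\,x\in\mathbb R^2\setminus\big((-\varepsilon l/2,\varepsilon l/2)\times\mathbb R\big),$$ and such that for every $L>\varepsilon h$ one has $(A_\varepsilon,S_\varepsilon\cap Q_L)\in\mathcal C_\varepsilon(Q_L)$ and $$F_\varepsilon(A_\varepsilon,Q_L)\le\frac1\varepsilon\mathcal F_\varepsilon(A_\varepsilon,S_\varepsilon\cap Q_L;Q_L)\le C\,L\,|R^--R^+|\big(\big|\log|R^--R^+|\big|+1\big).$$ 2. Consequently $$\psi_\infty(R^-,R^+)\le C\,|R^--R^+|\big(\big|\log|R^--R^+|\big|+1\big).$$ -/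

import Mathlib

open Set Filter Topology MeasureTheory
open scoped ContDiff ENNReal Matrix

namespace GrainBoundary

/-- The Euclidean plane. -/
abbrev Plane : Type := EuclideanSpace ℝ (Fin 2)

/-- Real `2 × 2` matrices. -/
abbrev Mat : Type := Matrix (Fin 2) (Fin 2) ℝ

/-- The rotation group `SO(2)`. -/
def SO2 : Set Mat := (Matrix.specialOrthogonalGroup (Fin 2) ℝ : Set Mat)

/-- The Euclidean (Frobenius) norm `|M| = (∑ᵢⱼ Mᵢⱼ²)^(1/2)`. -/
noncomputable def matNorm (M : Mat) : ℝ := √(∑ i, ∑ j, (M i j) ^ 2)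

/-- `dist(M, SO(2))` in the Euclidean norm. -/
noncomputable def distSO2 (M : Mat) : ℝ := ⨅ R : SO2, matNorm (M - R.1)

/-- The rotated gradient `∇^⊥ φ = J ∇φ` with `J = (0 1; -1 0)`. -/
noncomputable def gradPerp (φ : Plane → ℝ) (x : Plane) : Fin 2 → ℝ :=
  !![0, 1; -1, 0] *ᵥ fun i => fderiv ℝ φ x (EuclideanSpace.single i 1)

/-- `φ ∈ C_c^∞(U)`. -/
def IsTestFunction (U : Set Plane) (φ : Plane → ℝ) : Prop :=
  ContDiff ℝ ∞ φ ∧ HasCompactSupport φ ∧ tsupport φ ⊆ U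

/-- The vector `∫_Ω A ∇^⊥ φ dx`; with the rows of `Curl A` being `∂₁ A i 1 - ∂₂ A i 0`
(indices `0, 1` for the columns), this is the distribution `Curl A` tested with `φ`. -/
noncomputable def curlPairing (Ω : Set Plane) (A : Plane → Mat) (φ : Plane → ℝ) : Fin 2 → ℝ :=
  fun i => ∫ x in Ω, (A x *ᵥ gradPerp φ x) i

/-- The support in `Ω` of the distribution `Curl A`. -/
def curlSupport (Ω : Set Plane) (A : Plane → Mat) : Set Plane :=
  {x | x ∈ Ω ∧ ∀ U : Set Plane, IsOpen U → x ∈ U → U ⊆ Ω →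
    ∃ φ, IsTestFunction U φ ∧ curlPairing Ω A φ ≠ 0}

/-- `γ`, on the parameter interval `[0,1]`, is a simple rectifiable closed curve. -/
def IsSimpleRectifiableClosed (γ : ℝ → Plane) : Prop :=
  ContinuousOn γ (Icc 0 1) ∧ γ 0 = γ 1 ∧ InjOn γ (Ico 0 1) ∧ BoundedVariationOn γ (Icc 0 1)

/-- Every simple rectifiable closed curve `γ` in `Ω \ S` enclosing an open set `D ⊆ Ω`
has circulation in `c ℤ²`. The circulation is understood weakly: up to the sign given by the
orientation of `γ` (irrelevant here, since `c ℤ² = - c ℤ²`) it is `∫_Ω A ∇^⊥ φ` for any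
`φ ∈ C_c^∞(Ω)` with `φ = 1` on `D` and `supp φ \ D ⊆ Ω \ S`. The bounded open set `D` with
`∂D = γ` is the interior of the Jordan curve `γ`. -/
def LatticeCirculation (c : ℝ) (Ω : Set Plane) (A : Plane → Mat) (S : Set Plane) : Prop :=
  ∀ γ : ℝ → Plane, IsSimpleRectifiableClosed γ → γ '' Icc 0 1 ⊆ Ω \ S →
    ∀ D : Set Plane, IsOpen D → Bornology.IsBounded D → D ⊆ Ω → frontier D = γ '' Icc 0 1 →
      ∀ φ, IsTestFunction Ω φ → (∀ x ∈ D, φ x = 1) → tsupport φ \ D ⊆ Ω \ S →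
        ∃ k : Fin 2 → ℤ, ∀ i, curlPairing Ω A φ i = c * k i

/-- `S` is relatively closed in `Ω`, contains `supp (Curl A)`, and `A` has circulations in `c ℤ²`
around `S`. -/
structure LatticeCompatible (c : ℝ) (Ω : Set Plane) (A : Plane → Mat) (S : Set Plane) : Prop where
  relClosed : ∃ K : Set Plane, IsClosed K ∧ S = K ∩ Ω
  curl_subset : curlSupport Ω A ⊆ S
  circulation : LatticeCirculation c Ω A S

/-- The class `𝒞_ε(Ω)` of admissible pairs `(A, S)`, with `A ∈ L¹(Ω)`. -/
structure Admissible (τ ε : ℝ) (Ω : Set Plane) (A : Plane → Mat) (S : Set Plane) : Prop where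
  integrable : ∀ i j, IntegrableOn (fun x => A x i j) Ω
  compatible : LatticeCompatible (τ * ε) Ω A S

/-- The core region: the open `r`-neighbourhood of `S` in `Ω` (empty if `S` is empty). -/
def coreRegion (r : ℝ) (Ω S : Set Plane) : Set Plane := Metric.thickening r S ∩ Ω

/-- The Lauteri–Luckhaus energy `𝓕_ε(A, S)` on `Ω`, elastic plus core energy. -/
noncomputable def llEnergy (lam ε : ℝ) (Ω : Set Plane) (A : Plane → Mat) (S : Set Plane) : ℝ≥0∞ :=
  (∫⁻ x in Ω \ coreRegion (lam * ε) Ω S, ENNReal.ofReal (distSO2 (A x) ^ 2))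
    + volume (coreRegion (lam * ε) Ω S)

/-- The rescaled energy `F_ε(A, Ω) = ε⁻¹ inf {𝓕_ε(A, S) : (A, S) ∈ 𝒞_ε(Ω)}`. -/
noncomputable def fieldEnergy (lam τ ε : ℝ) (Ω : Set Plane) (A : Plane → Mat) : ℝ≥0∞ :=
  (⨅ (S : Set Plane) (_ : Admissible τ ε Ω A S), llEnergy lam ε Ω A S) / ENNReal.ofReal ε

/-- The open square `Q_L = (-L, L)²`. -/
def square (L : ℝ) : Set Plane := {x | ∀ i, x i ∈ Ioo (-L) L}

/-- The field `I_{R⁻,R⁺}`, equal to `R⁻` on `{x₁ < 0}` and to `R⁺` on `{x₁ ≥ 0}`. -/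
noncomputable def interfaceField (Rm Rp : Mat) (x : Plane) : Mat := if x 0 < 0 then Rm else Rp

/-- `A ∈ L¹_loc(ℝ²; ℝ^{2×2})`. -/
def LocIntegrable (A : Plane → Mat) : Prop := ∀ i j, LocallyIntegrable (fun x => A x i j)

/-- The optimal transition energy `ψ(R⁻, R⁺, L)`. -/
noncomputable def psi (lam τ : ℝ) (Rm Rp : Mat) (L : ℝ) : ℝ≥0∞ :=
  ⨅ (A : Plane → Mat) (_ : LocIntegrable A ∧
      ∃ L' < L, ∀ x, x ∉ square L' → A x = interfaceField Rm Rp x),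
    fieldEnergy lam τ 1 (square L) A

/-- The thermodynamic limit `ψ_∞(R⁻, R⁺)` of `ψ(R⁻, R⁺, L) / (2 L)` as `L → ∞`, taken as an upper
limit so that it is meaningful without knowing beforehand that the limit exists. -/
noncomputable def psiInf (lam τ : ℝ) (Rm Rp : Mat) : ℝ≥0∞ :=
  limsup (fun L : ℝ => psi lam τ Rm Rp L / ENNReal.ofReal (2 * L)) atTop

/-- Whenever the limit exists, it is `psiInf`. -/
theorem psiInf_eq_of_tendsto {lam τ : ℝ} {Rm Rp : Mat} {c : ℝ≥0∞}
    (h : Tendsto (fun L : ℝ => psi lam τ Rm Rp L / ENNReal.ofReal (2 * L)) atTop (𝓝 c)) :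
    psiInf lam τ Rm Rp = c :=
  h.limsup_eq

/-- The Read–Shockley expression `t (|log t| + 1)` (equal to `0` at `t = 0`). -/
noncomputable def readShockley (t : ℝ) : ℝ := t * (|Real.log t| + 1)

end GrainBoundary

/-!
Writing `A = R⁻ + w`, each row of `w` must vanish on the left, equal a row of `R⁺ - R⁻` on the
right, and have as curl a sum of charges in `τ ε ℤ`. The rows decouple, and only the second
(tangential) component `m` of the jump needs dislocations, since a jump of the normal component
across a vertical line has no curl. So it suffices to move, in the transition layer `0 ≤ x₁ < a`,
the density `m dy` at `x₁ = a` to charges `± τ ε` at `x₁ = 0`. A vector field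
`(-flux, density)` is curl-free exactly when the continuity equation holds, and here each cell of
height `2H = τ ε / |m|` is contracted along straight rays towards a segment of relative length
`b / (a + b)` (`wallRow`). Testing with `∇^⊥ φ` and integrating along the rays
(`integral_transport`) shows that the curl is the contracted density on these segments
(`hasSum_wallRow_pairing`).

The function `φ` in the circulation condition takes only the values `0` and `1` on the core `S`
(`latticeCompatible_of_pairing`), so it is constant on each segment, and each segment contributes
an integer multiple of its charge `± τ ε`; no property of Jordan curves is needed.

For the energy, `dist(A, SO(2)) ≤ |w|` in the layer and `A` is a rotation outside it. With
`θ = |R⁻ - R⁺|`, `a = ε / θ` and `b = ε`, the contraction gives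
`∫ |w|² ≲ L θ² (a + b) log ((a + b) / b)`, which is of order `ε L θ (|log θ| + 1)`, and the
`λ ε`-neighbourhoods of the segments have total area of order `ε L θ` (`llEnergy_le`).

For `ψ_∞` the field has to agree with the interface field near the top and bottom of the square,
too. It is overwritten there (`cutField`), and the damage is hidden in two half-strips that are
added to the core. They are connected and unbounded, so every admissible `φ` vanishes on them and
the circulation condition is unaffected; their cost is bounded as `L → ∞`.
-/

namespace GrainBoundary

/-! ### Coordinates on the plane -/

/-- The identification of `ℝ × ℝ` with the Euclidean plane. -/
noncomputable def ofCoords : ℝ × ℝ ≃ᵐ Plane :=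
  MeasurableEquiv.finTwoArrow.symm.trans (MeasurableEquiv.toLp 2 (Fin 2 → ℝ))

theorem ofCoords_apply (p : ℝ × ℝ) : ofCoords p = !₂[p.1, p.2] := rfl

@[simp] theorem ofCoords_zero (p : ℝ × ℝ) : ofCoords p 0 = p.1 := rfl

@[simp] theorem ofCoords_one (p : ℝ × ℝ) : ofCoords p 1 = p.2 := rfl

theorem ofCoords_self (x : Plane) : ofCoords (x 0, x 1) = x := by
  ext i; fin_cases i <;> rfl

theorem volume_preserving_ofCoords : MeasurePreserving ofCoords := by
  have h1 := (volume_preserving_finTwoArrow ℝ).symm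
  have h2 := (EuclideanSpace.volume_preserving_symm_measurableEquiv_toLp (Fin 2)).symm
  exact h2.comp h1

theorem continuous_ofCoords : Continuous ofCoords := by
  have : (fun p : ℝ × ℝ => ofCoords p) = fun p => !₂[p.1, p.2] := rfl
  change Continuous (fun p : ℝ × ℝ => ofCoords p)
  rw [this]
  refine (PiLp.continuous_toLp 2 _).comp (continuous_pi fun i => ?_)
  fin_cases i
  · exact continuous_fst
  · exact continuous_snd

theorem integral_eq_integral_coords (f : Plane → ℝ) : ∫ x, f x = ∫ p : ℝ × ℝ, f (ofCoords p) :=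
  (volume_preserving_ofCoords.integral_comp' f).symm

theorem volume_coord_box (I J : Set ℝ) :
    volume {x : Plane | x 0 ∈ I ∧ x 1 ∈ J} = volume I * volume J := by
  rw [← volume_preserving_ofCoords.measure_preimage_equiv, ← Measure.prod_prod,
    ← Measure.volume_eq_prod]
  rfl

theorem setLIntegral_coord_box (I J : Set ℝ) {f : Plane → ℝ≥0∞} (hf : Measurable f) :
    ∫⁻ x in {x : Plane | x 0 ∈ I ∧ x 1 ∈ J}, f x
      = ∫⁻ s in I, ∫⁻ t in J, f (ofCoords (s, t)) := by
  rw [← volume_preserving_ofCoords.setLIntegral_comp_preimage_emb ofCoords.measurableEmbedding]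
  have : ofCoords ⁻¹' {x : Plane | x 0 ∈ I ∧ x 1 ∈ J} = I ×ˢ J := rfl
  rw [this, Measure.volume_eq_prod, ← Measure.prod_restrict, lintegral_prod]
  exact (hf.comp ofCoords.measurable).aemeasurable

/-- The partial derivative `∂ᵢ φ`. -/
noncomputable def partialD (i : Fin 2) (φ : Plane → ℝ) (x : Plane) : ℝ :=
  fderiv ℝ φ x (EuclideanSpace.single i 1)

theorem gradPerp_zero (φ : Plane → ℝ) (x : Plane) : gradPerp φ x 0 = partialD 1 φ x := by
  simp [gradPerp, partialD, Matrix.mulVec, dotProduct, Fin.sum_univ_two]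

theorem gradPerp_one (φ : Plane → ℝ) (x : Plane) : gradPerp φ x 1 = -partialD 0 φ x := by
  simp [gradPerp, partialD, Matrix.mulVec, dotProduct, Fin.sum_univ_two]

variable {φ : Plane → ℝ}

theorem continuous_partialD (hφ : ContDiff ℝ ∞ φ) (i : Fin 2) : Continuous (partialD i φ) :=
  (hφ.continuous_fderiv (by simp)).clm_apply continuous_const

theorem partialD_eq_zero {x : Plane} (i : Fin 2) (hx : x ∉ tsupport φ) : partialD i φ x = 0 := by
  rw [partialD, fderiv_of_notMem_tsupport ℝ hx]; rfl

theorem hasCompactSupport_partialD (hc : HasCompactSupport φ) (i : Fin 2) :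
    HasCompactSupport (partialD i φ) :=
  HasCompactSupport.intro hc fun _ hx => partialD_eq_zero i hx

theorem hasDerivAt_comp_ofCoords (hφ : ContDiff ℝ ∞ φ) {f g : ℝ → ℝ} {f' g' t : ℝ}
    (hf : HasDerivAt f f' t) (hg : HasDerivAt g g' t) :
    HasDerivAt (fun t => φ (ofCoords (f t, g t)))
      (f' * partialD 0 φ (ofCoords (f t, g t)) + g' * partialD 1 φ (ofCoords (f t, g t))) t := by
  have h1 : HasDerivAt (fun t => ofCoords (f t, g t))
      (f' • EuclideanSpace.single 0 1 + g' • EuclideanSpace.single 1 1 : Plane) t := by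
    have h2 : HasDerivAt (fun t => (f t • EuclideanSpace.single 0 1
      + g t • EuclideanSpace.single 1 1 : Plane))
      (f' • EuclideanSpace.single 0 1 + g' • EuclideanSpace.single 1 1 : Plane) t :=
      (hf.smul_const _).add (hg.smul_const _)
    refine h2.congr_of_eventuallyEq (Eventually.of_forall fun t => ?_)
    ext i; fin_cases i <;> simp [ofCoords_apply]
  have h3 := ((hφ.differentiable (by simp)) (ofCoords (f t, g t))).hasFDerivAt.comp_hasDerivAt t h1
  simpa [partialD, Function.comp_def] using h3

/-- Beyond some bound in either coordinate, `φ` vanishes near the point. -/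
theorem exists_coord_bound (hc : HasCompactSupport φ) :
    ∃ R : ℝ, ∀ x : Plane, (R ≤ |x 0| ∨ R ≤ |x 1|) → x ∉ tsupport φ := by
  obtain ⟨R, hR⟩ := hc.isBounded.subset_closedBall 0
  refine ⟨R + 1, fun x hx hxs => ?_⟩
  have h := hR hxs
  rw [mem_closedBall_zero_iff] at h
  have h0 : ∀ i, |x i| ≤ ‖x‖ := fun i => PiLp.norm_apply_le x i
  rcases hx with hx | hx
  · linarith [h0 0]
  · linarith [h0 1]

/-- Integration along a family of straight rays: the density `1 / s` carried by the strip
`|y - c| ≤ H s`, `s = s₀ + k x`, and transported with velocity `k (y - c) / s`, is the image of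
the uniform density on `[-H, H]` under `Y ↦ c + s Y`. Testing it with the derivative of `φ` along
the flow leaves only the contributions of the two ends. -/
theorem integral_transport (hφ : ContDiff ℝ ∞ φ) {α β s₀ k H c : ℝ} (hαβ : α ≤ β) (hH : 0 ≤ H)
    (hs : ∀ x ∈ Icc α β, 0 < s₀ + k * x) :
    ∫ x in α..β, ∫ y in (c - H * (s₀ + k * x))..(c + H * (s₀ + k * x)),
      (s₀ + k * x)⁻¹ * (partialD 0 φ (ofCoords (x, y))
        + (k * (y - c) / (s₀ + k * x)) * partialD 1 φ (ofCoords (x, y)))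
    = ∫ Y in (-H)..H, (φ (ofCoords (β, c + (s₀ + k * β) * Y))
        - φ (ofCoords (α, c + (s₀ + k * α) * Y))) := by
  set G : ℝ → ℝ → ℝ := fun x Y => 1 * partialD 0 φ (ofCoords (x, c + (s₀ + k * x) * Y))
    + (k * Y) * partialD 1 φ (ofCoords (x, c + (s₀ + k * x) * Y)) with hG
  have hGc : Continuous (Function.uncurry G) := by
    have hm : Continuous fun p : ℝ × ℝ => ofCoords (p.1, c + (s₀ + k * p.1) * p.2) :=
      continuous_ofCoords.comp (by fun_prop)
    have h0 := (continuous_partialD hφ 0).comp hm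
    have h1 := (continuous_partialD hφ 1).comp hm
    exact (continuous_const.mul h0).add (Continuous.mul (by fun_prop) h1)
  have hinner : ∀ x ∈ uIcc α β, ∫ y in (c - H * (s₀ + k * x))..(c + H * (s₀ + k * x)),
      (s₀ + k * x)⁻¹ * (partialD 0 φ (ofCoords (x, y))
        + (k * (y - c) / (s₀ + k * x)) * partialD 1 φ (ofCoords (x, y)))
      = ∫ Y in (-H)..H, G x Y := by
    intro x hx
    rw [uIcc_of_le hαβ] at hx
    have hsx := hs x hx
    rw [intervalIntegral.integral_const_mul, ← smul_eq_mul]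
    have := intervalIntegral.integral_comp_add_mul (a := -H) (b := H) (fun y =>
      (partialD 0 φ (ofCoords (x, y))
        + (k * (y - c) / (s₀ + k * x)) * partialD 1 φ (ofCoords (x, y)))) hsx.ne' c
    rw [show c - H * (s₀ + k * x) = c + (s₀ + k * x) * (-H) by ring, mul_comm H, ← this]
    refine intervalIntegral.integral_congr fun Y _ => ?_
    simp only [hG]
    rw [show k * (c + (s₀ + k * x) * Y - c) / (s₀ + k * x) = k * Y by field_simp; ring]
    ring
  rw [intervalIntegral.integral_congr hinner]
  simp only [intervalIntegral.integral_of_le (neg_le_self hH)]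
  rw [intervalIntegral_integral_swap]
  · refine setIntegral_congr_fun measurableSet_Ioc fun Y _ => ?_
    refine intervalIntegral.integral_eq_sub_of_hasDerivAt
      (f := fun x => φ (ofCoords (x, c + (s₀ + k * x) * Y))) (fun x _ => ?_) ?_
    · have hlin : HasDerivAt (fun x : ℝ => c + (s₀ + k * x) * Y) (k * Y) x := by
        have := ((((hasDerivAt_id x).const_mul k).const_add s₀).mul_const Y).const_add c
        simpa using this
      exact hasDerivAt_comp_ofCoords hφ (hasDerivAt_id x) hlin
    · exact (hGc.comp (by fun_prop : Continuous fun x : ℝ => (x, Y))).intervalIntegrable _ _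
  · rw [Measure.prod_restrict, ← Measure.volume_eq_prod]
    refine (hGc.continuousOn.integrableOn_compact
      ((isCompact_uIcc (a := α) (b := β)).prod (isCompact_Icc (a := -H) (b := H)))).mono_set ?_
    exact prod_mono uIoc_subset_uIcc Ioc_subset_Icc_self

/-! ### The transported dislocation wall -/

/-- The index `j` of the cell `[2Hj - H, 2Hj + H)` containing `y`. -/
noncomputable def cellIndex (H y : ℝ) : ℤ := ⌊y / (2 * H) + 1 / 2⌋

/-- The position of `y` relative to the centre of its cell. -/
noncomputable def cellOffset (H y : ℝ) : ℝ := y - 2 * H * cellIndex H y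

/-- The `j`-th cell `[2Hj - H, 2Hj + H)`. -/
def cell (H : ℝ) (j : ℤ) : Set ℝ := Ico (2 * H * j - H) (2 * H * j + H)

/-- One row of the wall. It vanishes for `x₁ < 0` and equals `(0, m)` for `x₁ ≥ a`. In between, the
density `m dy` sitting on each cell of height `2H` at `x₁ = a` is contracted along straight rays
towards the segment of relative length `b / (a + b)` at `x₁ = 0`; the second component is that
density and the first one is minus its flux, so that the continuity equation makes the field
curl-free there. -/
noncomputable def wallRow (m H a b : ℝ) (x : Plane) : Fin 2 → ℝ :=
  if x 0 < 0 then 0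
  else if x 0 < a then
    if |cellOffset H (x 1)| ≤ H * ((b + x 0) / (a + b)) then
      (m * ((a + b) / (b + x 0))) • ![-(cellOffset H (x 1) / (b + x 0)), 1]
    else 0
  else ![0, m]

/-- The segments `{0} × [2Hj - Hσ, 2Hj + Hσ]`, `j ∈ ℤ`. -/
def wallSet (H σ : ℝ) : Set Plane := {x | x 0 = 0 ∧ ∃ j : ℤ, |x 1 - 2 * H * j| ≤ H * σ}

section Cells
variable {H : ℝ}

theorem cellIndex_eq_iff (hH : 0 < H) {y : ℝ} {j : ℤ} : cellIndex H y = j ↔ y ∈ cell H j := by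
  rw [cellIndex, Int.floor_eq_iff, cell, mem_Ico]
  have : y / (2 * H) + 1 / 2 = (y + H) / (2 * H) := by field_simp
  rw [this, le_div_iff₀ (by positivity), div_lt_iff₀ (by positivity)]
  constructor <;> rintro ⟨h1, h2⟩ <;> constructor <;> linarith

theorem cellOffset_eq (hH : 0 < H) {y : ℝ} {j : ℤ} (hy : y ∈ cell H j) :
    cellOffset H y = y - 2 * H * j := by
  rw [cellOffset, (cellIndex_eq_iff hH).2 hy]

theorem iUnion_cell (hH : 0 < H) : ⋃ j : ℤ, cell H j = univ :=
  eq_univ_of_forall fun y => mem_iUnion.2 ⟨cellIndex H y, (cellIndex_eq_iff hH).1 rfl⟩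

theorem pairwise_disjoint_cell (hH : 0 < H) : Pairwise (Function.onFun Disjoint (cell H)) := by
  intro i j hij
  refine disjoint_left.2 fun y hi hj => hij ?_
  rw [← (cellIndex_eq_iff hH).2 hi, (cellIndex_eq_iff hH).2 hj]

theorem measurable_cellIndex : Measurable (cellIndex H) :=
  Int.measurable_floor.comp (by fun_prop)

theorem measurable_cellOffset : Measurable (cellOffset H) := by
  have : Measurable fun y => (cellIndex H y : ℝ) :=
    (measurable_of_countable _).comp measurable_cellIndex
  exact measurable_id.sub (this.const_mul _)

end Cells

section Row
variable {m H a b : ℝ}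

theorem measurable_coord (i : Fin 2) : Measurable fun x : Plane => x i :=
  (by fun_prop : Continuous fun x : Plane => x i).measurable

theorem measurable_wallRow : Measurable (wallRow m H a b) := by
  have h0 := measurable_coord 0
  have hoff : Measurable fun x : Plane => cellOffset H (x 1) :=
    measurable_cellOffset.comp (measurable_coord 1)
  refine Measurable.ite (measurableSet_lt h0 measurable_const) measurable_const ?_
  refine Measurable.ite (measurableSet_lt h0 measurable_const) ?_ measurable_const
  refine Measurable.ite (measurableSet_le hoff.abs (by fun_prop)) ?_ measurable_const
  refine measurable_pi_lambda _ fun i => ?_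
  fin_cases i
  · simp only [Fin.zero_eta, Pi.smul_apply, Matrix.cons_val_zero, smul_eq_mul]
    exact Measurable.mul (by fun_prop) (hoff.div (by fun_prop)).neg
  · simp only [Fin.mk_one, Pi.smul_apply, Matrix.cons_val_one, Matrix.cons_val_fin_one,
      smul_eq_mul]
    fun_prop

theorem wallRow_of_neg {x : Plane} (hx : x 0 < 0) : wallRow m H a b x = 0 := if_pos hx

theorem wallRow_of_ge (ha : 0 ≤ a) {x : Plane} (hx : a ≤ x 0) : wallRow m H a b x = ![0, m] := by
  rw [wallRow, if_neg (by linarith), if_neg (by linarith)]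

/-- The slope of the rays is at most `H / (a + b)`. -/
theorem sq_wallRow_le (hH : 0 < H) (hb : 0 < b) {x : Plane} (h0 : 0 ≤ x 0)
    (hxa : x 0 < a) :
    wallRow m H a b x 0 ^ 2 + wallRow m H a b x 1 ^ 2 ≤
      {y | |cellOffset H y| ≤ H * ((b + x 0) / (a + b))}.indicator
        (fun _ => (m * ((a + b) / (b + x 0))) ^ 2 * (1 + (H / (a + b)) ^ 2)) (x 1) := by
  rw [wallRow, if_neg (by linarith), if_pos hxa]
  split_ifs with h
  · rw [indicator_of_mem (by exact h)]
    simp only [Pi.smul_apply, Matrix.cons_val_zero, Matrix.cons_val_one, Matrix.cons_val_fin_one,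
      smul_eq_mul]
    have hb' : 0 < b + x 0 := by linarith
    have : (cellOffset H (x 1) / (b + x 0)) ^ 2 ≤ (H / (a + b)) ^ 2 := by
      rw [sq_le_sq, abs_div, abs_div, abs_of_pos hb', abs_of_pos hH,
        abs_of_pos (by linarith : 0 < a + b), div_le_iff₀ hb']
      calc _ ≤ _ := h
        _ = _ := by ring
    have h2 := mul_le_mul_of_nonneg_left this (sq_nonneg (m * ((a + b) / (b + x 0))))
    nlinarith
  · rw [indicator_of_notMem (by exact h)]
    simp

theorem abs_wallRow_le (hH : 0 < H) (ha : 0 ≤ a) (hb : 0 < b) (i : Fin 2) (x : Plane) :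
    |wallRow m H a b x i| ≤ |m| + |m| * ((a + b) / b) * (1 + H / (a + b)) := by
  have hK : 0 ≤ |m| * ((a + b) / b) * (1 + H / (a + b)) := by positivity
  rcases lt_or_ge (x 0) 0 with h0 | h0
  · rw [wallRow_of_neg h0]; simp only [Pi.zero_apply, abs_zero]; positivity
  rcases lt_or_ge (x 0) a with h1 | h1
  swap
  · rw [wallRow_of_ge ha h1]
    fin_cases i
    · simp only [Fin.zero_eta, Matrix.cons_val_zero, abs_zero]; positivity
    · simp only [Fin.mk_one, Matrix.cons_val_one, Matrix.cons_val_fin_one]; linarith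
  refine le_trans ?_ (le_add_of_nonneg_left (abs_nonneg m))
  refine abs_le_of_sq_le_sq ?_ hK
  have h2 : wallRow m H a b x i ^ 2 ≤ wallRow m H a b x 0 ^ 2 + wallRow m H a b x 1 ^ 2 := by
    fin_cases i
    · exact le_add_of_nonneg_right (sq_nonneg _)
    · exact le_add_of_nonneg_left (sq_nonneg _)
  refine h2.trans ((sq_wallRow_le hH hb h0 h1).trans ?_)
  refine (indicator_le_self' (fun _ _ => by positivity) _).trans ?_
  have hb' : 0 < b + x 0 := by linarith
  rw [mul_pow, mul_pow, mul_pow, sq_abs]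
  have h3 : ((a + b) / (b + x 0)) ^ 2 ≤ ((a + b) / b) ^ 2 := by
    gcongr; linarith
  have h4 : 1 + (H / (a + b)) ^ 2 ≤ (1 + H / (a + b)) ^ 2 := by
    have : 0 ≤ H / (a + b) := by positivity
    nlinarith
  gcongr

theorem integrable_mul_partialD {f φ : Plane → ℝ} {K : ℝ} (hf : Measurable f)
    (hK : ∀ x, |f x| ≤ K) (hφ : ContDiff ℝ ∞ φ) (hc : HasCompactSupport φ) (i : Fin 2) :
    Integrable fun x => f x * partialD i φ x :=
  ((continuous_partialD hφ i).integrable_of_hasCompactSupport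
    (hasCompactSupport_partialD hc i)).bdd_mul hf.aestronglyMeasurable
    (Eventually.of_forall hK)

theorem wallRow_pairing_eq (x : Plane) (φ : Plane → ℝ) (h0 : 0 ≤ x 0)
    (hxa : x 0 < a) :
    wallRow m H a b x 0 * partialD 1 φ x - wallRow m H a b x 1 * partialD 0 φ x =
      {y | |cellOffset H y| ≤ H * ((b + x 0) / (a + b))}.indicator
        (fun _ => -m * (((a + b) / (b + x 0)) * (partialD 0 φ x +
          cellOffset H (x 1) / (b + x 0) * partialD 1 φ x))) (x 1) := by
  rw [wallRow, if_neg (by linarith), if_pos hxa]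
  split_ifs with h
  · rw [indicator_of_mem (by exact h)]
    simp only [Pi.smul_apply, Matrix.cons_val_zero, Matrix.cons_val_one, Matrix.cons_val_fin_one,
      smul_eq_mul]
    ring
  · rw [indicator_of_notMem (by exact h)]
    simp

theorem integrable_wallRow_pairing (hH : 0 < H) (ha : 0 ≤ a) (hb : 0 < b) {φ : Plane → ℝ}
    (hφ : ContDiff ℝ ∞ φ) (hc : HasCompactSupport φ) :
    Integrable fun x =>
      wallRow m H a b x 0 * partialD 1 φ x - wallRow m H a b x 1 * partialD 0 φ x :=
  (integrable_mul_partialD ((measurable_pi_apply 0).comp measurable_wallRow)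
    (abs_wallRow_le hH ha hb 0) hφ hc 1).sub
  (integrable_mul_partialD ((measurable_pi_apply 1).comp measurable_wallRow)
    (abs_wallRow_le hH ha hb 1) hφ hc 0)

theorem setIntegral_cell_wallRow (hH : 0 < H) (ha : 0 ≤ a) (hb : 0 < b) {φ : Plane → ℝ}
    (hφ : ContDiff ℝ ∞ φ) (hc : HasCompactSupport φ) (j : ℤ) :
    ∫ p in (univ : Set ℝ) ×ˢ cell H j,
      (wallRow m H a b (ofCoords p) 0 * partialD 1 φ (ofCoords p)
        - wallRow m H a b (ofCoords p) 1 * partialD 0 φ (ofCoords p))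
    = m * ∫ Y in (-H)..H, φ (ofCoords (0, 2 * H * j + b / (a + b) * Y)) := by
  have hd : 0 < a + b := by linarith
  set c : ℝ := 2 * H * j with hcdef
  set P : Plane → ℝ := fun x =>
    wallRow m H a b x 0 * partialD 1 φ x - wallRow m H a b x 1 * partialD 0 φ x with hP
  have hPint : Integrable fun p : ℝ × ℝ => P (ofCoords p) :=
    volume_preserving_ofCoords.integrable_comp_of_integrable
      (integrable_wallRow_pairing hH ha hb hφ hc)
  obtain ⟨R₀, hR₀⟩ := exists_coord_bound hc
  set R := max R₀ a with hRdef
  have haR : a ≤ R := le_max_right _ _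
  have hR : ∀ x : ℝ, R ≤ x → ∀ y, ofCoords (x, y) ∉ tsupport φ := fun x hx y =>
    hR₀ _ (Or.inl (((le_max_left _ _).trans hx).trans (le_abs_self _)))
  change ∫ p in (univ : Set ℝ) ×ˢ cell H j, P (ofCoords p) = _
  rw [Measure.volume_eq_prod] at hPint ⊢
  rw [setIntegral_prod _ hPint.integrableOn, Measure.restrict_univ]
  set J : ℝ → ℝ := fun x => ∫ y in cell H j, P (ofCoords (x, y)) with hJ
  have hJint : Integrable J := by
    have : IntegrableOn (fun p : ℝ × ℝ => P (ofCoords p)) (univ ×ˢ cell H j)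
      (volume.prod volume) := hPint.integrableOn
    rw [IntegrableOn, ← Measure.prod_restrict, Measure.restrict_univ] at this
    exact this.integral_prod_left
  -- the integrand lives on `0 ≤ x₁ < R`
  have hsupp : ∫ x, J x = ∫ x in Ico 0 R, J x := by
    rw [← integral_indicator measurableSet_Ico]
    congr 1
    ext x
    by_cases hx : x ∈ Ico 0 R
    · rw [indicator_of_mem hx]
    rw [indicator_of_notMem hx]
    refine setIntegral_eq_zero_of_forall_eq_zero fun y _ => ?_
    rw [mem_Ico, not_and_or, not_le, not_lt] at hx
    rcases hx with hx | hx
    · simp [hP, wallRow_of_neg (show ofCoords (x, y) 0 < 0 from hx)]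
    · simp [hP, partialD_eq_zero _ (hR x hx y)]
  have hsplit : ∫ x in Ico 0 R, J x = (∫ x in Ico 0 a, J x) + ∫ x in Ico a R, J x := by
    rw [← setIntegral_union _ measurableSet_Ico hJint.integrableOn hJint.integrableOn,
      Ico_union_Ico_eq_Ico ha haR]
    exact disjoint_left.2 fun x h1 h2 => absurd h1.2 (not_lt.2 h2.1)
  have hs0 : ∀ x, b / (a + b) + 1 / (a + b) * x = (b + x) / (a + b) := fun x => by ring
  have h1 : ∫ x in Ico 0 a, J x = -m * ∫ Y in (-H)..H, (φ (ofCoords (a, c + 1 * Y))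
      - φ (ofCoords (0, c + b / (a + b) * Y))) := by
    have key := integral_transport (H := H) (c := c) (s₀ := b / (a + b)) (k := 1 / (a + b)) hφ ha
      hH.le (fun x hx => by rw [hs0]; have := hx.1; positivity)
    rw [hs0 a, hs0 0, add_zero, add_comm b a, div_self hd.ne'] at key
    rw [← key, intervalIntegral.integral_of_le ha, ← integral_Ico_eq_integral_Ioc,
      ← integral_const_mul]
    refine setIntegral_congr_fun measurableSet_Ico fun x hx => ?_
    have hbx : 0 < b + x := by linarith [hx.1]
    simp only [hs0]
    set r := H * ((b + x) / (a + b)) with hr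
    have hrH : r ≤ H := by
      have : (b + x) / (a + b) ≤ 1 := by rw [div_le_one hd]; linarith [hx.2]
      nlinarith
    have hr0 : 0 < r := by positivity
    rw [intervalIntegral.integral_of_le (by linarith), ← integral_Icc_eq_integral_Ioc,
      ← integral_const_mul]
    have hcongr : J x = ∫ y in cell H j, (Icc (c - r) (c + r)).indicator (fun y =>
        -m * (((b + x) / (a + b))⁻¹ * (partialD 0 φ (ofCoords (x, y)) +
          1 / (a + b) * (y - c) / ((b + x) / (a + b)) * partialD 1 φ (ofCoords (x, y))))) y := by
      refine setIntegral_congr_fun measurableSet_Ico fun y hy => ?_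
      have hoff := cellOffset_eq hH hy
      simp only [hP]
      rw [wallRow_pairing_eq _ _ hx.1 hx.2]
      have hiff : y ∈ {y | |cellOffset H y| ≤ H * ((b + x) / (a + b))} ↔
          y ∈ Icc (c - r) (c + r) := by
        rw [mem_ofPred_eq, hoff, abs_le, mem_Icc]
        constructor <;> rintro ⟨h1, h2⟩ <;> constructor <;> linarith
      by_cases hy' : y ∈ Icc (c - r) (c + r)
      · rw [indicator_of_mem hy', indicator_of_mem (by exact hiff.2 hy')]
        simp only [ofCoords_zero, ofCoords_one, hoff]
        rw [inv_div, show 1 / (a + b) * (y - c) / ((b + x) / (a + b)) = (y - c) / (b + x) by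
          field_simp]
      · rw [indicator_of_notMem hy']
        exact indicator_of_notMem (fun h => hy' (hiff.1 h)) _
    rw [hcongr, setIntegral_indicator measurableSet_Icc]
    -- `Icc (c - r) (c + r)` exceeds the half-open cell by at most its right end point
    refine setIntegral_congr_set ?_
    rw [cell]
    refine (Ico_ae_eq_Icc.inter (ae_eq_refl _)).trans (Eq.eventuallyEq ?_)
    exact inter_eq_right.2 (Icc_subset_Icc (by linarith) (by linarith))
  have h2 : ∫ x in Ico a R, J x = -m * ∫ Y in (-H)..H, (φ (ofCoords (R, c + 1 * Y))
      - φ (ofCoords (a, c + 1 * Y))) := by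
    have key := integral_transport (H := H) (c := c) (s₀ := 1) (k := 0) hφ haR
      hH.le (fun x _ => by simp)
    simp only [zero_mul, add_zero] at key
    rw [← key, intervalIntegral.integral_of_le haR, ← integral_Ico_eq_integral_Ioc,
      ← integral_const_mul]
    refine setIntegral_congr_fun measurableSet_Ico fun x hx => ?_
    rw [intervalIntegral.integral_of_le (by linarith), ← integral_Ico_eq_integral_Ioc,
      ← integral_const_mul, mul_one]
    refine setIntegral_congr_fun measurableSet_Ico fun y _ => ?_
    simp [hP, wallRow_of_ge ha (show a ≤ ofCoords (x, y) 0 from hx.1)]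
  have hcont : ∀ t s : ℝ, IntervalIntegrable (fun Y => φ (ofCoords (t, c + s * Y))) volume (-H) H :=
    fun t s => (hφ.continuous.comp (continuous_ofCoords.comp (by fun_prop))).intervalIntegrable _ _
  have hR0 : ∀ Y, φ (ofCoords (R, c + 1 * Y)) = 0 := fun Y =>
    image_eq_zero_of_notMem_tsupport (hR R le_rfl _)
  rw [hsupp, hsplit, h1, h2, intervalIntegral.integral_sub (hcont _ _) (hcont _ _),
    intervalIntegral.integral_sub (hcont _ _) (hcont _ _)]
  simp only [hR0, intervalIntegral.integral_zero]
  ring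

/-- The curl of the wall row is the sum over the cells of the measure `m dY` on `[-H, H]`, contracted
to the segment of that cell in `{x₁ = 0}`. -/
theorem hasSum_wallRow_pairing (hH : 0 < H) (ha : 0 ≤ a) (hb : 0 < b) {φ : Plane → ℝ}
    (hφ : ContDiff ℝ ∞ φ) (hc : HasCompactSupport φ) :
    HasSum (fun j : ℤ => m * ∫ Y in (-H)..H, φ (ofCoords (0, 2 * H * j + b / (a + b) * Y)))
      (∫ x, (wallRow m H a b x 0 * partialD 1 φ x - wallRow m H a b x 1 * partialD 0 φ x)) := by
  have hPint := volume_preserving_ofCoords.integrable_comp_of_integrable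
      (integrable_wallRow_pairing (m := m) hH ha hb hφ hc)
  have hU : ⋃ j : ℤ, (univ : Set ℝ) ×ˢ cell H j = univ := by
    rw [← prod_iUnion, iUnion_cell hH, univ_prod_univ]
  have := hasSum_integral_iUnion (fun j : ℤ => MeasurableSet.univ.prod measurableSet_Ico)
    (fun i j hij => (pairwise_disjoint_cell hH hij).set_prod_right univ univ)
    (f := (fun x => wallRow m H a b x 0 * partialD 1 φ x
      - wallRow m H a b x 1 * partialD 0 φ x) ∘ ofCoords) (μ := volume) hPint.integrableOn
  change HasSum _ (∫ x in ⋃ j : ℤ, (univ : Set ℝ) ×ˢ cell H j, _) at this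
  rw [hU, setIntegral_univ] at this
  rw [integral_eq_integral_coords]
  refine this.congr_fun fun j => ?_
  exact (setIntegral_cell_wallRow hH ha hb hφ hc j).symm

end Row

/-! ### Quantization of the circulation -/

theorem eq_of_eq_zero_or_one {X : Type*} [TopologicalSpace X] {s : Set X} (hs : IsPreconnected s)
    {f : X → ℝ} (hf : ContinuousOn f s) (h01 : ∀ x ∈ s, f x = 0 ∨ f x = 1) {x y : X}
    (hx : x ∈ s) (hy : y ∈ s) : f x = f y := by
  exact hs.constant_of_mapsTo (T := {0, 1}) (Set.toFinite _).isDiscrete hf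
    (fun z hz => h01 z hz) hx hy

theorem exists_int_of_hasSum {ι : Type*} {c : ℝ} (hc : c ≠ 0) {f : ι → ℝ} {X : ℝ} (h : HasSum f X)
    (hf : ∀ i, ∃ k : ℤ, f i = c * k) : ∃ k : ℤ, X = c * k := by
  choose k hk using hf
  have h' : HasSum (fun i => (k i : ℝ)) (c⁻¹ * X) := by
    refine (h.mul_left c⁻¹).congr_fun fun i => ?_
    rw [hk, inv_mul_cancel_left₀ hc]
  have hmem : c⁻¹ * X ∈ range (Int.cast : ℤ → ℝ) :=
    Int.isClosedEmbedding_coe_real.isClosed_range.mem_of_tendsto h'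
      (Eventually.of_forall fun s => ⟨∑ i ∈ s, k i, by push_cast; rfl⟩)
  obtain ⟨n, hn⟩ := hmem
  exact ⟨n, by rw [hn, mul_inv_cancel_left₀ hc]⟩

open scoped Pointwise in
theorem isClosed_wallSet (H σ : ℝ) : IsClosed (wallSet H σ) := by
  have hZ : IsClosed (range fun j : ℤ => 2 * H * (j : ℝ)) := by
    rcases eq_or_ne (2 * H) 0 with h | h
    · simp only [h, zero_mul]
      exact (Set.finite_range_const).isClosed
    · have := (Homeomorph.mulLeft₀ (2 * H) h).isClosedMap _
        Int.isClosedEmbedding_coe_real.isClosed_range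
      rwa [← range_comp] at this
  have h2 := hZ.add_right_of_isCompact (isCompact_Icc (a := -(H * σ)) (b := H * σ))
  have h0 : IsClosed {x : Plane | x 0 = 0} := isClosed_eq (by fun_prop) continuous_const
  have h3 : IsClosed ((fun x : Plane => x 1) ⁻¹'
      ((range fun j : ℤ => 2 * H * (j : ℝ)) + Icc (-(H * σ)) (H * σ))) :=
    h2.preimage (by fun_prop)
  convert h0.inter h3 using 1
  ext x
  refine and_congr_right fun _ => ?_
  simp only [mem_preimage, Set.mem_add, mem_range]
  constructor
  · rintro ⟨j, hj⟩
    exact ⟨2 * H * j, ⟨j, rfl⟩, x 1 - 2 * H * j, abs_le.1 hj, by ring⟩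
  · rintro ⟨_, ⟨j, rfl⟩, t, ht, h⟩
    exact ⟨j, abs_le.2 (by rw [← h]; simpa using ht)⟩

section Pairing
variable {m H a b : ℝ} {φ : Plane → ℝ}

theorem mem_wallSet_of_mem_Icc {σ : ℝ} (hσ : 0 ≤ σ) (j : ℤ) {Y : ℝ} (hY : Y ∈ Icc (-H) H) :
    ofCoords (0, 2 * H * j + σ * Y) ∈ wallSet H σ := by
  refine ⟨rfl, j, ?_⟩
  rw [ofCoords_one, add_sub_cancel_left, abs_mul, abs_of_nonneg hσ, mul_comm]
  exact mul_le_mul_of_nonneg_right (abs_le.2 hY) hσ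

theorem wallRow_pairing_eq_zero (hH : 0 < H) (ha : 0 ≤ a) (hb : 0 < b) (hφ : ContDiff ℝ ∞ φ)
    (hc : HasCompactSupport φ) (h0 : ∀ x ∈ wallSet H (b / (a + b)), φ x = 0) :
    ∫ x, (wallRow m H a b x 0 * partialD 1 φ x - wallRow m H a b x 1 * partialD 0 φ x) = 0 := by
  refine (hasSum_wallRow_pairing hH ha hb hφ hc).unique ?_
  convert hasSum_zero with j
  rw [intervalIntegral.integral_congr (g := fun _ => 0), intervalIntegral.integral_zero, mul_zero]
  intro Y hY
  rw [uIcc_of_le (neg_le_self hH.le)] at hY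
  exact h0 _ (mem_wallSet_of_mem_Icc (by positivity) j hY)

/-- Each segment carries the total charge `2 H m`, and `φ` is constant on it. -/
theorem exists_int_wallRow_pairing (hH : 0 < H) (ha : 0 ≤ a) (hb : 0 < b) (hm : m ≠ 0)
    (hφ : ContDiff ℝ ∞ φ) (hc : HasCompactSupport φ)
    (h01 : ∀ x ∈ wallSet H (b / (a + b)), φ x = 0 ∨ φ x = 1) :
    ∃ k : ℤ, ∫ x, (wallRow m H a b x 0 * partialD 1 φ x - wallRow m H a b x 1 * partialD 0 φ x)
      = (2 * H * m) * k := by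
  refine exists_int_of_hasSum (by positivity) (hasSum_wallRow_pairing hH ha hb hφ hc) fun j => ?_
  have hmem := fun {Y : ℝ} (hY : Y ∈ Icc (-H) H) =>
    mem_wallSet_of_mem_Icc (H := H) (σ := b / (a + b)) (by positivity) j hY
  have h0 : (0 : ℝ) ∈ Icc (-H) H := ⟨by linarith, hH.le⟩
  have hcst : ∀ Y ∈ Icc (-H) H, φ (ofCoords (0, 2 * H * j + b / (a + b) * Y))
      = φ (ofCoords (0, 2 * H * j + b / (a + b) * 0)) := fun Y hY =>
    eq_of_eq_zero_or_one (f := fun Y => φ (ofCoords (0, 2 * H * j + b / (a + b) * Y)))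
      isPreconnected_Icc
      (hφ.continuous.comp (continuous_ofCoords.comp (by fun_prop))).continuousOn
      (fun Y hY => h01 _ (hmem hY)) hY h0
  rw [intervalIntegral.integral_congr (g := fun _ =>
    φ (ofCoords (0, 2 * H * j + b / (a + b) * 0))), intervalIntegral.integral_const]
  swap
  · intro Y hY
    rw [uIcc_of_le (neg_le_self hH.le)] at hY
    exact hcst Y hY
  rcases h01 _ (hmem h0) with h | h
  · exact ⟨0, by rw [h]; simp⟩
  · exact ⟨1, by rw [h]; simp; ring⟩

end Pairing

/-! ### Energy of the wall -/

section Energy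
variable {m H a b L : ℝ}

/-- The number of cells centred within distance `H` of `(-L, L)`. -/
theorem exists_cell_count (hH : 0 < H) (hL : H ≤ L) : ∃ n : ℤ,
    (((Finset.Icc (-n) n).card : ℕ) : ℝ) ≤ 3 * L / H ∧
    ∀ y ∈ Ioo (-L) L, ∀ j : ℤ, |y - 2 * H * j| ≤ H → j ∈ Finset.Icc (-n) n := by
  refine ⟨⌊L / (2 * H) + 1 / 2⌋, ?_, fun y hy j hj => ?_⟩
  · set n := ⌊L / (2 * H) + 1 / 2⌋ with hn
    have hn0 : 0 ≤ n := Int.floor_nonneg.2 (by have : 0 < L := hH.trans_le hL; positivity)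
    have hnl : (n : ℝ) ≤ L / (2 * H) + 1 / 2 := Int.floor_le _
    have hcard : (((Finset.Icc (-n) n).card : ℕ) : ℝ) = 2 * n + 1 := by
      rw [Int.card_Icc]
      have : ((n + 1 - -n).toNat : ℤ) = 2 * n + 1 := by omega
      exact_mod_cast this
    have h1 : 1 ≤ L / H := (one_le_div hH).2 hL
    have h2 : L / (2 * H) = L / H / 2 := by field_simp
    rw [hcard, mul_div_assoc]
    linarith
  · obtain ⟨h1, h2⟩ := abs_le.1 hj
    have hrw : L / (2 * H) + 1 / 2 = (L + H) / (2 * H) := by field_simp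
    rw [Finset.mem_Icc, neg_le, Int.le_floor, Int.le_floor, hrw, le_div_iff₀ (by positivity),
      le_div_iff₀ (by positivity)]
    push_cast
    constructor <;> linarith [hy.1, hy.2]

theorem volume_offset_le (hH : 0 < H) (hL : H ≤ L) {r : ℝ} :
    volume (Ioo (-L) L ∩ {y | |cellOffset H y| ≤ r}) ≤ ENNReal.ofReal (3 * L / H * (2 * r)) := by
  obtain ⟨n, hn, hmem⟩ := exists_cell_count hH hL
  have hsub : Ioo (-L) L ∩ {y | |cellOffset H y| ≤ r} ⊆
      ⋃ j ∈ Finset.Icc (-n) n, Icc (2 * H * (j : ℝ) - r) (2 * H * j + r) := by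
    rintro y ⟨hy, hyr⟩
    have hcell := (cellIndex_eq_iff hH).1 (rfl : cellIndex H y = _)
    refine mem_biUnion (x := cellIndex H y) (hmem y hy _ ?_) ?_
    · exact abs_le.2 ⟨by linarith [hcell.1], by linarith [hcell.2]⟩
    · obtain ⟨h1, h2⟩ := abs_le.1 (show |y - 2 * H * cellIndex H y| ≤ r from hyr)
      exact ⟨by linarith, by linarith⟩
  refine (measure_mono hsub).trans ((measure_biUnion_finset_le _ _).trans ?_)
  have hvol : ∀ j : ℤ, volume (Icc (2 * H * (j : ℝ) - r) (2 * H * j + r))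
      = ENNReal.ofReal (2 * r) := fun j => by rw [Real.volume_Icc]; congr 1; ring
  simp only [hvol, Finset.sum_const, nsmul_eq_mul]
  have hL0 : 0 < L := hH.trans_le hL
  calc _ ≤ ENNReal.ofReal (3 * L / H) * ENNReal.ofReal (2 * r) := by
        rw [← ENNReal.ofReal_natCast]; gcongr
    _ = _ := (ENNReal.ofReal_mul (by positivity)).symm

theorem lintegral_wallRow_le (hH : 0 < H) (ha : 0 ≤ a) (hb : 0 < b) (hL : H ≤ L) :
    ∫⁻ x in {x : Plane | x 0 ∈ Ico 0 a ∧ x 1 ∈ Ioo (-L) L},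
      ENNReal.ofReal (wallRow m H a b x 0 ^ 2 + wallRow m H a b x 1 ^ 2)
    ≤ ENNReal.ofReal (6 * L * m ^ 2 * (1 + (H / (a + b)) ^ 2) * ((a + b) * Real.log ((a + b) / b)))
    := by
  have hd : 0 < a + b := by linarith
  have hL0 : 0 < L := hH.trans_le hL
  have hmeas : Measurable fun x =>
      ENNReal.ofReal (wallRow m H a b x 0 ^ 2 + wallRow m H a b x 1 ^ 2) :=
    ((((measurable_pi_apply 0).comp measurable_wallRow).pow_const 2).add
      (((measurable_pi_apply 1).comp measurable_wallRow).pow_const 2)).ennreal_ofReal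
  rw [setLIntegral_coord_box _ _ hmeas]
  set B : ℝ := 6 * L * m ^ 2 * (1 + (H / (a + b)) ^ 2) * (a + b) with hB
  have hslice : ∀ s ∈ Ico 0 a, ∫⁻ t in Ioo (-L) L,
      ENNReal.ofReal (wallRow m H a b (ofCoords (s, t)) 0 ^ 2
        + wallRow m H a b (ofCoords (s, t)) 1 ^ 2) ≤ ENNReal.ofReal (B * (b + s)⁻¹) := by
    intro s hs
    have hbs : 0 < b + s := by linarith [hs.1]
    set r := H * ((b + s) / (a + b)) with hr
    set q := (m * ((a + b) / (b + s))) ^ 2 * (1 + (H / (a + b)) ^ 2) with hq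
    have hmset : MeasurableSet {y | |cellOffset H y| ≤ r} :=
      measurableSet_le measurable_cellOffset.abs measurable_const
    calc _ ≤ ∫⁻ t in Ioo (-L) L, {y | |cellOffset H y| ≤ r}.indicator
          (fun _ => ENNReal.ofReal q) t := by
          refine lintegral_mono fun t => ?_
          refine (ENNReal.ofReal_le_ofReal (sq_wallRow_le hH hb
            (show 0 ≤ ofCoords (s, t) 0 from hs.1) (show ofCoords (s, t) 0 < a from hs.2))).trans ?_
          simp only [ofCoords_zero, ofCoords_one]
          by_cases ht : t ∈ {y | |cellOffset H y| ≤ r}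
          · rw [indicator_of_mem ht, indicator_of_mem ht]
          · rw [indicator_of_notMem ht, indicator_of_notMem ht, ENNReal.ofReal_zero]
      _ = ENNReal.ofReal q * volume (Ioo (-L) L ∩ {y | |cellOffset H y| ≤ r}) := by
          rw [lintegral_indicator hmset, setLIntegral_const, Measure.restrict_apply hmset,
            inter_comm]
      _ ≤ ENNReal.ofReal q * ENNReal.ofReal (3 * L / H * (2 * r)) := by
          gcongr
          exact volume_offset_le hH hL
      _ = ENNReal.ofReal (B * (b + s)⁻¹) := by
          rw [← ENNReal.ofReal_mul (by positivity)]
          congr 1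
          rw [hq, hr, hB]
          field_simp
          ring
  refine (setLIntegral_mono' measurableSet_Ico hslice).trans ?_
  have hcont : ContinuousOn (fun s => B * (b + s)⁻¹) (Icc 0 a) := by
    refine continuousOn_const.mul (ContinuousOn.inv₀ (by fun_prop) fun s hs => ?_)
    have := hs.1; positivity
  rw [← ofReal_integral_eq_lintegral_ofReal
    ((hcont.integrableOn_compact isCompact_Icc).mono_set Ico_subset_Icc_self)
    (ae_restrict_of_forall_mem measurableSet_Ico fun s hs => by have := hs.1; positivity)]
  refine ENNReal.ofReal_le_ofReal (le_of_eq ?_)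
  rw [integral_Ico_eq_integral_Ioc, ← intervalIntegral.integral_of_le ha,
    intervalIntegral.integral_const_mul,
    intervalIntegral.integral_comp_add_left (fun s => s⁻¹) b, add_zero,
    integral_inv_of_pos hb (by linarith), hB, add_comm b a]
  ring

theorem volume_thickening_wallSet_le (hH : 0 < H) (hL : H ≤ L) {r σ : ℝ} (hr : 0 ≤ r)
    (hσ1 : σ ≤ 1) :
    volume (Metric.thickening r (wallSet H σ ∩ square L))
      ≤ ENNReal.ofReal (12 * L * r * (σ + r / H)) := by
  obtain ⟨n, hn, hmem⟩ := exists_cell_count hH hL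
  have hsub : Metric.thickening r (wallSet H σ ∩ square L) ⊆
      ⋃ j ∈ Finset.Icc (-n) n, {x : Plane | x 0 ∈ Ioo (-r) r ∧
        x 1 ∈ Ioo (2 * H * (j : ℝ) - (H * σ + r)) (2 * H * j + (H * σ + r))} := by
    intro x hx
    obtain ⟨z, ⟨⟨hz0, j, hj⟩, hzL⟩, hxz⟩ := Metric.mem_thickening_iff.1 hx
    have hd : ∀ i, |x i - z i| < r := fun i =>
      (PiLp.norm_apply_le (x - z) i).trans_lt (by rwa [← dist_eq_norm])
    have h0 := abs_lt.1 (hd 0)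
    have h1 := abs_lt.1 (hd 1)
    have h2 := abs_le.1 hj
    rw [hz0] at h0
    refine mem_biUnion (x := j) (hmem _ (hzL 1) j (hj.trans ?_)) ⟨⟨?_, ?_⟩, ⟨?_, ?_⟩⟩
    · exact mul_le_of_le_one_right hH.le hσ1
    all_goals linarith
  refine (measure_mono hsub).trans ((measure_biUnion_finset_le _ _).trans ?_)
  have hvol : ∀ j : ℤ, volume {x : Plane | x 0 ∈ Ioo (-r) r ∧
        x 1 ∈ Ioo (2 * H * (j : ℝ) - (H * σ + r)) (2 * H * j + (H * σ + r))}
      = ENNReal.ofReal (2 * r * (2 * (H * σ + r))) := fun j => by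
    rw [volume_coord_box, Real.volume_Ioo, Real.volume_Ioo, ← ENNReal.ofReal_mul (by linarith)]
    congr 1; ring
  simp only [hvol, Finset.sum_const, nsmul_eq_mul]
  have hL0 : 0 < L := hH.trans_le hL
  calc _ ≤ ENNReal.ofReal (3 * L / H) * ENNReal.ofReal (2 * r * (2 * (H * σ + r))) := by
        rw [← ENNReal.ofReal_natCast]; gcongr
    _ = _ := by
        rw [← ENNReal.ofReal_mul (by positivity)]
        congr 1
        field_simp
        ring

end Energy

/-! ### Admissibility from circulations tested on `S` -/

theorem curlPairing_eq_univ {Ω : Set Plane} {A : Plane → Mat} {φ : Plane → ℝ}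
    (hφ : tsupport φ ⊆ Ω) : curlPairing Ω A φ = curlPairing univ A φ := by
  ext i
  rw [curlPairing, curlPairing, setIntegral_univ]
  refine setIntegral_eq_integral_of_forall_compl_eq_zero fun x hx => ?_
  have hx' : x ∉ tsupport φ := fun h => hx (hφ h)
  simp [Matrix.mulVec, dotProduct, Fin.sum_univ_two, gradPerp_zero, gradPerp_one,
    partialD_eq_zero _ hx']

theorem IsTestFunction.mono {U V : Set Plane} {φ : Plane → ℝ} (h : IsTestFunction U φ)
    (hUV : U ⊆ V) : IsTestFunction V φ := ⟨h.1, h.2.1, h.2.2.trans hUV⟩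

/-- A function `φ` as in the definition of the circulation takes only the values `0` and `1` on `S`,
since `S ∩ supp φ ⊆ D`. Hence the curve bounding `D` plays no role. -/
theorem latticeCompatible_of_pairing {c : ℝ} {Ω S : Set Plane} {A : Plane → Mat} (hΩ : IsOpen Ω)
    (hS : IsClosed S)
    (h0 : ∀ φ, IsTestFunction Ω φ → (∀ x ∈ S, φ x = 0) → curlPairing univ A φ = 0)
    (h1 : ∀ φ, IsTestFunction Ω φ → (∀ x ∈ S, φ x = 0 ∨ φ x = 1) →
      ∃ k : Fin 2 → ℤ, ∀ i, curlPairing univ A φ i = c * k i) :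
    LatticeCompatible c Ω A (S ∩ Ω) := by
  refine ⟨⟨S, hS, rfl⟩, fun x hx => ?_, fun γ _ _ D _ _ _ _ φ hφ hD hsupp => ?_⟩
  · by_contra hxS
    have hxS' : x ∉ S := fun h => hxS ⟨h, hx.1⟩
    obtain ⟨φ, hφ, hne⟩ := hx.2 (Ω ∩ Sᶜ) (hΩ.inter hS.isOpen_compl) ⟨hx.1, hxS'⟩
      inter_subset_left
    have hφΩ := hφ.mono inter_subset_left
    refine hne ?_
    rw [curlPairing_eq_univ hφΩ.2.2]
    refine h0 φ hφΩ fun y hy => image_eq_zero_of_notMem_tsupport fun h => ?_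
    exact (hφ.2.2 h).2 hy
  · rw [curlPairing_eq_univ hφ.2.2]
    refine h1 φ hφ fun x hx => ?_
    by_cases hxs : x ∈ tsupport φ
    · right
      by_contra hne
      have hxD : x ∉ D := fun h => hne (hD x h)
      exact (hsupp ⟨hxs, hxD⟩).2 ⟨hx, hφ.2.2 hxs⟩
    · exact Or.inl (image_eq_zero_of_notMem_tsupport hxs)

/-! ### The grain boundary field -/

/-- The wall core of one row: the dislocation segments for the spacing `c / |m|`, and no
dislocation at all if there is no jump. -/
noncomputable def rowCore (c m σ : ℝ) : Set Plane :=
  if m = 0 then ∅ else wallSet (c / (2 * |m|)) σ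

/-- The row of the wall with jump `m` and charges `± c`. For `m = 0` the cell height `c / 0` is
meaningless, but the row vanishes (`wallRow_zero`). -/
noncomputable abbrev latticeRow (c m a b : ℝ) : Plane → Fin 2 → ℝ := wallRow m (c / (2 * |m|)) a b

/-- The transition field. Each row carries the dislocation wall that realizes the jump of its
tangential component, while the normal component jumps from `R⁻ + wall` to `R⁺` at `x₁ = a`, which
produces no curl. -/
noncomputable def wallField (c a b : ℝ) (Rm Rp : Mat) (x : Plane) : Mat :=
  Matrix.of fun i k =>
    if x 0 < 0 then Rm i k
    else if x 0 < a then Rm i k + latticeRow c (Rp i 1 - Rm i 1) a b x k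
    else Rp i k

/-- The union of the wall cores of the two rows. -/
noncomputable def wallCore (c a b : ℝ) (Rm Rp : Mat) : Set Plane :=
  ⋃ i, rowCore c (Rp i 1 - Rm i 1) (b / (a + b))

section Field
variable {c a b m : ℝ} {Rm Rp : Mat} {φ : Plane → ℝ}

theorem wallRow_zero (H a b : ℝ) (x : Plane) : wallRow 0 H a b x = 0 := by
  rw [wallRow]
  split_ifs <;> simp

theorem isClosed_wallCore : IsClosed (wallCore c a b Rm Rp) := by
  refine isClosed_iUnion_of_finite fun i => ?_
  rw [rowCore]
  split_ifs
  · exact isClosed_empty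
  · exact isClosed_wallSet _ _

theorem abs_latticeRow_le (hc : 0 < c) (ha : 0 ≤ a) (hb : 0 < b) :
    ∃ K, ∀ x i, |latticeRow c m a b x i| ≤ K := by
  by_cases hm : m = 0
  · exact ⟨0, fun x i => by simp [latticeRow, hm, wallRow_zero]⟩
  · exact ⟨_, fun x i => abs_wallRow_le (by positivity) ha hb i x⟩

theorem integrable_latticeRow_pairing (hc : 0 < c) (ha : 0 ≤ a) (hb : 0 < b)
    (hφ : ContDiff ℝ ∞ φ) (hφc : HasCompactSupport φ) :
    Integrable fun x =>
      latticeRow c m a b x 0 * partialD 1 φ x - latticeRow c m a b x 1 * partialD 0 φ x := by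
  obtain ⟨K, hK⟩ := abs_latticeRow_le (m := m) hc ha hb
  exact (integrable_mul_partialD ((measurable_pi_apply 0).comp measurable_wallRow)
    (fun x => hK x 0) hφ hφc 1).sub
    (integrable_mul_partialD ((measurable_pi_apply 1).comp measurable_wallRow)
    (fun x => hK x 1) hφ hφc 0)

theorem latticeRow_pairing_eq_zero (hc : 0 < c) (ha : 0 ≤ a) (hb : 0 < b) (hφ : ContDiff ℝ ∞ φ)
    (hφc : HasCompactSupport φ) (h0 : ∀ x ∈ rowCore c m (b / (a + b)), φ x = 0) :
    ∫ x, (latticeRow c m a b x 0 * partialD 1 φ x - latticeRow c m a b x 1 * partialD 0 φ x)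
      = 0 := by
  by_cases hm : m = 0
  · simp [latticeRow, hm, wallRow_zero]
  · rw [rowCore, if_neg hm] at h0
    exact wallRow_pairing_eq_zero (by positivity) ha hb hφ hφc h0

theorem exists_int_latticeRow_pairing (hc : 0 < c) (ha : 0 ≤ a) (hb : 0 < b)
    (hφ : ContDiff ℝ ∞ φ) (hφc : HasCompactSupport φ)
    (h01 : ∀ x ∈ rowCore c m (b / (a + b)), φ x = 0 ∨ φ x = 1) :
    ∃ k : ℤ, ∫ x, (latticeRow c m a b x 0 * partialD 1 φ x
      - latticeRow c m a b x 1 * partialD 0 φ x) = c * k := by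
  by_cases hm : m = 0
  · exact ⟨0, by simp [latticeRow, hm, wallRow_zero]⟩
  · rw [rowCore, if_neg hm] at h01
    obtain ⟨k, hk⟩ := exists_int_wallRow_pairing (by positivity) ha hb hm hφ hφc h01
    rcases lt_or_gt_of_ne hm with h | h
    · refine ⟨-k, hk.trans ?_⟩
      rw [abs_of_neg h]; push_cast; field_simp
    · refine ⟨k, hk.trans ?_⟩
      rw [abs_of_pos h]; field_simp

theorem integral_mul_partialD_one_eq_zero {f : ℝ → ℝ} {K : ℝ} (hf : Measurable f)
    (hK : ∀ s, |f s| ≤ K) (hφ : ContDiff ℝ ∞ φ) (hφc : HasCompactSupport φ) :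
    ∫ x : Plane, f (x 0) * partialD 1 φ x = 0 := by
  have hint := volume_preserving_ofCoords.integrable_comp_of_integrable
    (integrable_mul_partialD (hf.comp (measurable_coord 0)) (fun x => hK _) hφ hφc 1)
  rw [integral_eq_integral_coords, Measure.volume_eq_prod]
  rw [Measure.volume_eq_prod] at hint
  refine (integral_prod _ hint).trans ?_
  refine integral_eq_zero_of_ae (Eventually.of_forall fun s => ?_)
  obtain ⟨R, hR⟩ := exists_coord_bound hφc
  have hline : Continuous fun t : ℝ => ofCoords (s, t) := continuous_ofCoords.comp (by fun_prop)
  have hcs : ∀ g : Plane → ℝ, (∀ x, x ∉ tsupport φ → g x = 0) → Continuous g →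
      Integrable fun t => g (ofCoords (s, t)) := fun g hg hgc =>
    (hgc.comp hline).integrable_of_hasCompactSupport
      (HasCompactSupport.intro (isCompact_Icc (a := -R) (b := R)) fun t ht =>
        hg _ (hR _ (Or.inr (by
          rw [mem_Icc, ← abs_le, not_le] at ht
          exact ht.le))))
  have hz := integral_eq_zero_of_hasDerivAt_of_integrable
    (f := fun t => φ (ofCoords (s, t))) (f' := fun t => partialD 1 φ (ofCoords (s, t)))
    (fun t => by
      have := hasDerivAt_comp_ofCoords hφ (hasDerivAt_const t s) (hasDerivAt_id t)
      simpa using this)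
    (hcs _ (fun x hx => partialD_eq_zero 1 hx) (continuous_partialD hφ 1))
    (hcs _ (fun x hx => image_eq_zero_of_notMem_tsupport hx) hφ.continuous)
  simp only [Function.comp_apply, ofCoords_zero, integral_const_mul, hz, mul_zero, Pi.zero_apply]

theorem integral_partialD_zero_eq_zero (hφ : ContDiff ℝ ∞ φ) (hφc : HasCompactSupport φ) :
    ∫ x : Plane, partialD 0 φ x = 0 := by
  have hint := volume_preserving_ofCoords.integrable_comp_of_integrable
    ((continuous_partialD hφ 0).integrable_of_hasCompactSupport (hasCompactSupport_partialD hφc 0))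
  rw [integral_eq_integral_coords, Measure.volume_eq_prod]
  rw [Measure.volume_eq_prod] at hint
  refine (integral_prod_symm _ hint).trans ?_
  refine integral_eq_zero_of_ae (Eventually.of_forall fun t => ?_)
  obtain ⟨R, hR⟩ := exists_coord_bound hφc
  have hline : Continuous fun s : ℝ => ofCoords (s, t) := continuous_ofCoords.comp (by fun_prop)
  have hcs : ∀ g : Plane → ℝ, (∀ x, x ∉ tsupport φ → g x = 0) → Continuous g →
      Integrable fun s => g (ofCoords (s, t)) := fun g hg hgc =>
    (hgc.comp hline).integrable_of_hasCompactSupport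
      (HasCompactSupport.intro (isCompact_Icc (a := -R) (b := R)) fun s hs =>
        hg _ (hR _ (Or.inl (by
          rw [mem_Icc, ← abs_le, not_le] at hs
          exact hs.le))))
  exact integral_eq_zero_of_hasDerivAt_of_integrable
    (f := fun s => φ (ofCoords (s, t))) (f' := fun s => partialD 0 φ (ofCoords (s, t)))
    (fun s => by
      have := hasDerivAt_comp_ofCoords hφ (hasDerivAt_id s) (hasDerivAt_const s t)
      simpa using this)
    (hcs _ (fun x hx => partialD_eq_zero 0 hx) (continuous_partialD hφ 0))
    (hcs _ (fun x hx => image_eq_zero_of_notMem_tsupport hx) hφ.continuous)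

theorem wallField_apply (ha : 0 ≤ a) (x : Plane) (i : Fin 2) :
    (wallField c a b Rm Rp x i 0 = Rm i 0 + latticeRow c (Rp i 1 - Rm i 1) a b x 0
      + (Ici a).indicator (fun _ => Rp i 0 - Rm i 0) (x 0)) ∧
    wallField c a b Rm Rp x i 1 = Rm i 1 + latticeRow c (Rp i 1 - Rm i 1) a b x 1 := by
  simp only [wallField, Matrix.of_apply]
  rcases lt_or_ge (x 0) 0 with h0 | h0
  · have : x 0 ∉ Ici a := fun h => absurd (ha.trans h) (not_le.2 h0)
    simp [h0, latticeRow, wallRow_of_neg h0, indicator_of_notMem this]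
  rcases lt_or_ge (x 0) a with h1 | h1
  · simp [not_lt.2 h0, h1]
  · have : x 0 ∈ Ici a := h1
    simp [not_lt.2 h0, not_lt.2 h1, latticeRow, wallRow_of_ge ha h1, indicator_of_mem this]

theorem curlPairing_wallField (hc : 0 < c) (ha : 0 ≤ a) (hb : 0 < b) (hφ : ContDiff ℝ ∞ φ)
    (hφc : HasCompactSupport φ) (i : Fin 2) :
    curlPairing univ (wallField c a b Rm Rp) φ i =
      ∫ x, (latticeRow c (Rp i 1 - Rm i 1) a b x 0 * partialD 1 φ x
        - latticeRow c (Rp i 1 - Rm i 1) a b x 1 * partialD 0 φ x) := by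
  set f : ℝ → ℝ := fun s => Rm i 0 + (Ici a).indicator (fun _ => Rp i 0 - Rm i 0) s with hf
  have hfm : Measurable f := measurable_const.add (measurable_const.indicator measurableSet_Ici)
  have hfK : ∀ s, |f s| ≤ |Rm i 0| + |Rp i 0 - Rm i 0| := fun s => by
    refine (abs_add_le _ _).trans (add_le_add_right ?_ _)
    by_cases hs : s ∈ Ici a
    · rw [indicator_of_mem hs]
    · rw [indicator_of_notMem hs, abs_zero]; positivity
  have h1 : Integrable fun x : Plane => f (x 0) * partialD 1 φ x :=
    integrable_mul_partialD (hfm.comp (measurable_coord 0)) (fun x => hfK _) hφ hφc 1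
  have h2 := integrable_mul_partialD (f := fun _ => Rm i 1) measurable_const (fun _ => le_rfl)
    hφ hφc 0
  have h12 : Integrable fun x : Plane => f (x 0) * partialD 1 φ x - Rm i 1 * partialD 0 φ x :=
    h1.sub h2
  have hsplit : ∀ x, (wallField c a b Rm Rp x *ᵥ gradPerp φ x) i =
      ((f (x 0) * partialD 1 φ x) - Rm i 1 * partialD 0 φ x) +
      (latticeRow c (Rp i 1 - Rm i 1) a b x 0 * partialD 1 φ x
        - latticeRow c (Rp i 1 - Rm i 1) a b x 1 * partialD 0 φ x) := fun x => by
    obtain ⟨e0, e1⟩ := wallField_apply (c := c) (b := b) (Rm := Rm) (Rp := Rp) ha x i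
    rw [Matrix.mulVec, dotProduct, Fin.sum_univ_two, gradPerp_zero, gradPerp_one, e0, e1, hf]
    ring
  rw [curlPairing, setIntegral_univ]
  simp only [hsplit]
  rw [integral_add h12 (integrable_latticeRow_pairing hc ha hb hφ hφc),
    integral_sub h1 h2, integral_mul_partialD_one_eq_zero hfm hfK hφ hφc,
    integral_const_mul, integral_partialD_zero_eq_zero hφ hφc]
  ring

theorem measurable_wallField (ha : 0 ≤ a) (i k : Fin 2) :
    Measurable fun x => wallField c a b Rm Rp x i k := by
  have h0 : ∀ k, Measurable fun x => latticeRow c (Rp i 1 - Rm i 1) a b x k := fun k =>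
    (measurable_pi_apply k).comp measurable_wallRow
  fin_cases k
  · simp only [Fin.zero_eta, (wallField_apply ha _ i).1]
    exact ((h0 0).const_add _).add
      ((measurable_const.indicator measurableSet_Ici).comp (measurable_coord 0))
  · simp only [Fin.mk_one, (wallField_apply ha _ i).2]
    exact (h0 1).const_add _

theorem abs_wallField_le (hc : 0 < c) (ha : 0 ≤ a) (hb : 0 < b) (i k : Fin 2) :
    ∃ K, ∀ x, |wallField c a b Rm Rp x i k| ≤ K := by
  obtain ⟨K, hK⟩ := abs_latticeRow_le (m := Rp i 1 - Rm i 1) hc ha hb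
  refine ⟨|Rm i k| + |K| + |Rp i k|, fun x => ?_⟩
  have h1 := (hK x k).trans (le_abs_self K)
  have h2 := abs_nonneg (Rm i k)
  have h3 := abs_nonneg (Rp i k)
  have h4 := abs_nonneg K
  simp only [wallField, Matrix.of_apply]
  split_ifs
  · linarith
  · linarith [abs_add_le (Rm i k) (latticeRow c (Rp i 1 - Rm i 1) a b x k)]
  · linarith

theorem curlPairing_wallField_eq_zero (hc : 0 < c) (ha : 0 ≤ a) (hb : 0 < b)
    (hφ : ContDiff ℝ ∞ φ) (hφc : HasCompactSupport φ)
    (h0 : ∀ x ∈ wallCore c a b Rm Rp, φ x = 0) :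
    curlPairing univ (wallField c a b Rm Rp) φ = 0 := by
  ext i
  rw [curlPairing_wallField hc ha hb hφ hφc i]
  exact latticeRow_pairing_eq_zero hc ha hb hφ hφc fun x hx => h0 x (mem_iUnion.2 ⟨i, hx⟩)

theorem exists_int_curlPairing_wallField (hc : 0 < c) (ha : 0 ≤ a) (hb : 0 < b)
    (hφ : ContDiff ℝ ∞ φ) (hφc : HasCompactSupport φ)
    (h01 : ∀ x ∈ wallCore c a b Rm Rp, φ x = 0 ∨ φ x = 1) :
    ∃ k : Fin 2 → ℤ, ∀ i, curlPairing univ (wallField c a b Rm Rp) φ i = c * k i := by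
  have : ∀ i, ∃ k : ℤ, curlPairing univ (wallField c a b Rm Rp) φ i = c * k := fun i => by
    rw [curlPairing_wallField hc ha hb hφ hφc i]
    exact exists_int_latticeRow_pairing hc ha hb hφ hφc fun x hx => h01 x (mem_iUnion.2 ⟨i, hx⟩)
  choose k hk using this
  exact ⟨k, hk⟩

theorem latticeCompatible_wallField (hc : 0 < c) (ha : 0 ≤ a) (hb : 0 < b) {Ω : Set Plane}
    (hΩ : IsOpen Ω) :
    LatticeCompatible c Ω (wallField c a b Rm Rp) (wallCore c a b Rm Rp ∩ Ω) :=
  latticeCompatible_of_pairing hΩ isClosed_wallCore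
    (fun _ hφ h0 => curlPairing_wallField_eq_zero hc ha hb hφ.1 hφ.2.1 h0)
    (fun _ hφ h01 => exists_int_curlPairing_wallField hc ha hb hφ.1 hφ.2.1 h01)

theorem wallField_eq_interfaceField (ha : 0 ≤ a) {x : Plane} (hx : x 0 ∉ Ico 0 a) :
    wallField c a b Rm Rp x = interfaceField Rm Rp x := by
  ext i k
  rw [mem_Ico, not_and_or, not_le, not_lt] at hx
  simp only [wallField, interfaceField, Matrix.of_apply]
  rcases hx with hx | hx
  · simp [hx]
  · simp [not_lt.2 hx, not_lt.2 (ha.trans hx)]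

end Field

/-! ### Distance to the rotations -/

theorem matNorm_nonneg (M : Mat) : 0 ≤ matNorm M := Real.sqrt_nonneg _

theorem matNorm_sq (M : Mat) : matNorm M ^ 2 = ∑ i, ∑ j, (M i j) ^ 2 :=
  Real.sq_sqrt (Finset.sum_nonneg fun _ _ => Finset.sum_nonneg fun _ _ => sq_nonneg _)

theorem abs_apply_le_matNorm (M : Mat) (i j : Fin 2) : |M i j| ≤ matNorm M := by
  refine Real.abs_le_sqrt ?_
  refine (Finset.single_le_sum (f := fun j => (M i j) ^ 2) (fun _ _ => sq_nonneg _)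
    (Finset.mem_univ j)).trans ?_
  exact Finset.single_le_sum (f := fun i => ∑ j, (M i j) ^ 2)
    (fun _ _ => Finset.sum_nonneg fun _ _ => sq_nonneg _) (Finset.mem_univ i)

theorem abs_apply_le_one {R : Mat} (hR : R ∈ SO2) (i j : Fin 2) : |R i j| ≤ 1 :=
  entry_norm_bound_of_unitary
    ((Matrix.mem_specialOrthogonalGroup_iff.1 (show R ∈ Matrix.specialOrthogonalGroup _ _ from hR)).1)
    i j

theorem matNorm_sub_le_four {R R' : Mat} (hR : R ∈ SO2) (hR' : R' ∈ SO2) :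
    matNorm (R - R') ≤ 4 := by
  have h : ∀ i j, ((R - R') i j) ^ 2 ≤ 4 := fun i j => by
    have h1 := abs_le.1 (abs_apply_le_one hR i j)
    have h2 := abs_le.1 (abs_apply_le_one hR' i j)
    rw [Matrix.sub_apply]
    nlinarith
  refine Real.sqrt_le_iff.2 ⟨by norm_num, ?_⟩
  simp only [Fin.sum_univ_two]
  linarith [h 0 0, h 0 1, h 1 0, h 1 1]

theorem distSO2_nonneg (M : Mat) : 0 ≤ distSO2 M := Real.iInf_nonneg fun _ => matNorm_nonneg _

theorem distSO2_le {M R : Mat} (hR : R ∈ SO2) : distSO2 M ≤ matNorm (M - R) :=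
  ciInf_le (f := fun R : SO2 => matNorm (M - R.1))
    ⟨0, by rintro _ ⟨R, rfl⟩; exact matNorm_nonneg _⟩ ⟨R, hR⟩

theorem distSO2_eq_zero {R : Mat} (hR : R ∈ SO2) : distSO2 R = 0 := by
  refine le_antisymm ((distSO2_le hR).trans (le_of_eq ?_)) (distSO2_nonneg _)
  simp [matNorm]

theorem interfaceField_mem {Rm Rp : Mat} (hm : Rm ∈ SO2) (hp : Rp ∈ SO2) (x : Plane) :
    interfaceField Rm Rp x ∈ SO2 := by
  rw [interfaceField]
  split_ifs <;> assumption

/-! ### Energy of the transition field -/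

theorem square_eq_box (L : ℝ) : square L = {x | x 0 ∈ Ioo (-L) L ∧ x 1 ∈ Ioo (-L) L} := by
  ext x
  exact Fin.forall_fin_two

theorem isOpen_square (L : ℝ) : IsOpen (square L) := by
  rw [square_eq_box]
  exact (isOpen_Ioo.preimage (by fun_prop : Continuous fun x : Plane => x 0)).inter
    (isOpen_Ioo.preimage (by fun_prop : Continuous fun x : Plane => x 1))

theorem volume_square_lt_top (L : ℝ) : volume (square L) < ⊤ := by
  rw [square_eq_box, volume_coord_box, Real.volume_Ioo]
  exact ENNReal.mul_lt_top ENNReal.ofReal_lt_top ENNReal.ofReal_lt_top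

theorem distSO2_wallField_sq_le {c a b : ℝ} {Rm Rp : Mat} (hm : Rm ∈ SO2) {x : Plane}
    (hx : x 0 ∈ Ico 0 a) : distSO2 (wallField c a b Rm Rp x) ^ 2 ≤
      ∑ i, (latticeRow c (Rp i 1 - Rm i 1) a b x 0 ^ 2
        + latticeRow c (Rp i 1 - Rm i 1) a b x 1 ^ 2) := by
  refine (pow_le_pow_left₀ (distSO2_nonneg _) (distSO2_le hm) 2).trans (le_of_eq ?_)
  rw [matNorm_sq]
  refine Finset.sum_congr rfl fun i _ => ?_
  simp [wallField, not_lt.2 hx.1, hx.2]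

theorem lintegral_distSO2_le {c a b L : ℝ} {Rm Rp : Mat} (hm : Rm ∈ SO2) (hp : Rp ∈ SO2)
    (ha : 0 ≤ a) {A : Plane → Mat} (hA : ∀ x, A x = wallField c a b Rm Rp x ∨ A x ∈ SO2)
    (S : Set Plane) :
    ∫⁻ x in square L \ S, ENNReal.ofReal (distSO2 (A x) ^ 2) ≤
      ∑ i, ∫⁻ x in {x : Plane | x 0 ∈ Ico 0 a ∧ x 1 ∈ Ioo (-L) L},
        ENNReal.ofReal (latticeRow c (Rp i 1 - Rm i 1) a b x 0 ^ 2
        + latticeRow c (Rp i 1 - Rm i 1) a b x 1 ^ 2) := by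
  have hmeas : ∀ i, Measurable fun x =>
      ENNReal.ofReal (latticeRow c (Rp i 1 - Rm i 1) a b x 0 ^ 2
        + latticeRow c (Rp i 1 - Rm i 1) a b x 1 ^ 2) := fun i =>
    ((((measurable_pi_apply 0).comp measurable_wallRow).pow_const 2).add
      (((measurable_pi_apply 1).comp measurable_wallRow).pow_const 2)).ennreal_ofReal
  set T : Set Plane := {x | x 0 ∈ Ico 0 a} with hT
  have hTm : MeasurableSet T := measurableSet_Ico.preimage (measurable_coord 0)
  have hpt : ∀ x, ENNReal.ofReal (distSO2 (A x) ^ 2) ≤ T.indicator (fun x =>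
      ∑ i, ENNReal.ofReal (latticeRow c (Rp i 1 - Rm i 1) a b x 0 ^ 2
        + latticeRow c (Rp i 1 - Rm i 1) a b x 1 ^ 2)) x := by
    intro x
    have hzero : A x ∈ SO2 → ENNReal.ofReal (distSO2 (A x) ^ 2) = 0 := fun h => by
      simp [distSO2_eq_zero h]
    rcases hA x with h | h
    · by_cases hx : x ∈ T
      · rw [indicator_of_mem hx, h, ← ENNReal.ofReal_sum_of_nonneg (fun _ _ => by positivity)]
        exact ENNReal.ofReal_le_ofReal (distSO2_wallField_sq_le hm hx)
      · rw [hzero]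
        · exact zero_le
        · rw [h, wallField_eq_interfaceField ha hx]
          exact interfaceField_mem hm hp x
    · rw [hzero h]; exact zero_le
  calc _ ≤ ∫⁻ x in square L, ENNReal.ofReal (distSO2 (A x) ^ 2) :=
        lintegral_mono_set sdiff_subset
    _ ≤ ∫⁻ x in square L, T.indicator (fun x =>
      ∑ i, ENNReal.ofReal (latticeRow c (Rp i 1 - Rm i 1) a b x 0 ^ 2
        + latticeRow c (Rp i 1 - Rm i 1) a b x 1 ^ 2)) x := lintegral_mono hpt
    _ = ∫⁻ x in T ∩ square L,
      ∑ i, ENNReal.ofReal (latticeRow c (Rp i 1 - Rm i 1) a b x 0 ^ 2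
        + latticeRow c (Rp i 1 - Rm i 1) a b x 1 ^ 2) := setLIntegral_indicator hTm _
    _ ≤ ∫⁻ x in {x : Plane | x 0 ∈ Ico 0 a ∧ x 1 ∈ Ioo (-L) L},
      ∑ i, ENNReal.ofReal (latticeRow c (Rp i 1 - Rm i 1) a b x 0 ^ 2
        + latticeRow c (Rp i 1 - Rm i 1) a b x 1 ^ 2) :=
        lintegral_mono_set fun x hx => ⟨hx.1, hx.2 1⟩
    _ = _ := lintegral_finsetSum _ fun i _ => hmeas i

theorem readShockley_nonneg {t : ℝ} (ht : 0 ≤ t) : 0 ≤ readShockley t := by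
  rw [readShockley]; positivity

/-- With the width `a = ε / θ` of the wall and the core size `b = ε`, the slope part `H / (a + b)`
and the density part `m` of the field contribute at the same order `θ`, and the contraction
contributes the factor `log ((a + b) / b) = log (1 + 1 / θ)`. -/
theorem lintegral_latticeRow_le {τ ε m θ L : ℝ} (hτ : 0 < τ) (hε : 0 < ε) (hm : |m| ≤ θ)
    (hθ : θ ≤ 4) (hL : ε * (τ / (2 * |m|)) ≤ L) :
    ∫⁻ x in {x : Plane | x 0 ∈ Ico 0 (ε / θ) ∧ x 1 ∈ Ioo (-L) L},
      ENNReal.ofReal (latticeRow (τ * ε) m (ε / θ) ε x 0 ^ 2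
        + latticeRow (τ * ε) m (ε / θ) ε x 1 ^ 2)
    ≤ ENNReal.ofReal (ε * (24 * (5 + τ ^ 2 / 4) * L * readShockley θ)) := by
  by_cases hm0 : m = 0
  · simp [latticeRow, hm0, wallRow_zero]
  have hmpos : 0 < |m| := abs_pos.2 hm0
  have hθ0 : 0 < θ := hmpos.trans_le hm
  have hL0 : 0 < L := lt_of_lt_of_le (by positivity) hL
  refine (lintegral_wallRow_le (by positivity) (by positivity) hε
    (le_trans (le_of_eq (by ring)) hL)).trans (ENNReal.ofReal_le_ofReal ?_)
  have hd : ε / θ + ε = ε * (1 + θ) / θ := by field_simp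
  have hlog : Real.log ((ε / θ + ε) / ε) ≤ 4 * (|Real.log θ| + 1) := by
    rw [hd, show ε * (1 + θ) / θ / ε = (1 + θ) / θ by field_simp,
      Real.log_div (by positivity) hθ0.ne']
    have h1 : Real.log (1 + θ) ≤ θ := by
      have := Real.log_le_sub_one_of_pos (show 0 < 1 + θ by linarith)
      linarith
    have h2 := neg_abs_le (Real.log θ)
    have h3 := abs_nonneg (Real.log θ)
    linarith
  have hcoef : m ^ 2 * (1 + (τ * ε / (2 * |m|) / (ε / θ + ε)) ^ 2) * (ε / θ + ε)
      ≤ ε * θ * (5 + τ ^ 2 / 4) := by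
    have e1 : m ^ 2 * (1 + (τ * ε / (2 * |m|) / (ε / θ + ε)) ^ 2) * (ε / θ + ε)
        = ε * (m ^ 2 * (1 + θ) / θ) + ε * (τ ^ 2 / 4 * (θ / (1 + θ))) := by
      rw [hd, ← sq_abs m]; field_simp; ring
    have e2 : m ^ 2 * (1 + θ) / θ ≤ 5 * θ := by
      rw [div_le_iff₀ hθ0]
      have : m ^ 2 ≤ θ ^ 2 := by rw [← sq_abs m]; gcongr
      nlinarith [sq_nonneg θ, sq_nonneg m]
    have e3 : θ / (1 + θ) ≤ θ := div_le_self hθ0.le (by linarith)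
    rw [e1]
    calc _ ≤ ε * (5 * θ) + ε * (τ ^ 2 / 4 * θ) := by gcongr
      _ = _ := by ring
  calc _ = 6 * L * (m ^ 2 * (1 + (τ * ε / (2 * |m|) / (ε / θ + ε)) ^ 2) * (ε / θ + ε))
        * Real.log ((ε / θ + ε) / ε) := by ring
    _ ≤ 6 * L * (ε * θ * (5 + τ ^ 2 / 4)) * (4 * (|Real.log θ| + 1)) := by
        have : 0 ≤ Real.log ((ε / θ + ε) / ε) := Real.log_nonneg (by
          rw [one_le_div hε]
          have : 0 ≤ ε / θ := by positivity
          linarith)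
        gcongr
    _ = _ := by rw [readShockley]; ring

theorem volume_thickening_rowCore_le {lam τ ε m θ L : ℝ} (hlam : 0 < lam) (hτ : 0 < τ)
    (hε : 0 < ε) (hm : |m| ≤ θ) (hL : ε * (τ / (2 * |m|)) ≤ L) :
    volume (Metric.thickening (lam * ε) (rowCore (τ * ε) m (ε / (ε / θ + ε)) ∩ square L))
    ≤ ENNReal.ofReal (ε * (12 * lam * (1 + 2 * lam / τ) * L * readShockley θ)) := by
  by_cases hm0 : m = 0
  · simp [rowCore, hm0]
  have hmpos : 0 < |m| := abs_pos.2 hm0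
  have hθ0 : 0 < θ := hmpos.trans_le hm
  have hL0 : 0 < L := lt_of_lt_of_le (by positivity) hL
  rw [rowCore, if_neg hm0]
  have hσ : ε / (ε / θ + ε) = θ / (1 + θ) := by field_simp
  refine (volume_thickening_wallSet_le (by positivity) (le_trans (le_of_eq (by ring)) hL)
    (by positivity) ?_).trans (ENNReal.ofReal_le_ofReal ?_)
  · rw [hσ, div_le_one (by positivity)]; linarith
  · have e1 : lam * ε / (τ * ε / (2 * |m|)) = 2 * lam / τ * |m| := by field_simp
    have e3 : θ / (1 + θ) ≤ θ := div_le_self hθ0.le (by linarith)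
    rw [hσ, e1]
    calc 12 * L * (lam * ε) * (θ / (1 + θ) + 2 * lam / τ * |m|)
        ≤ 12 * L * (lam * ε) * (θ + 2 * lam / τ * θ) := by gcongr
      _ = ε * (12 * lam * (1 + 2 * lam / τ) * L * (θ * 1)) := by ring
      _ ≤ _ := by
        rw [readShockley]
        gcongr
        linarith [abs_nonneg (Real.log θ)]

/-- The constant in the Read–Shockley bound. -/
noncomputable def rsConst (lam τ : ℝ) : ℝ :=
  48 * (5 + τ ^ 2 / 4) + 24 * lam * (1 + 2 * lam / τ)

theorem rsConst_pos {lam τ : ℝ} (hlam : 0 < lam) (hτ : 0 < τ) : 0 < rsConst lam τ := by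
  rw [rsConst]; positivity

/-- The half-height of the cells of the wall of a row, at scale `ε = 1`, is below this. A row without a
jump has no cells, and its summand is `τ / 0 = 0`. -/
noncomputable def rsHeight (τ : ℝ) (Rm Rp : Mat) : ℝ :=
  τ / (2 * |Rp 0 1 - Rm 0 1|) + τ / (2 * |Rp 1 1 - Rm 1 1|) + 1

theorem rsHeight_pos {τ : ℝ} (hτ : 0 < τ) (Rm Rp : Mat) : 0 < rsHeight τ Rm Rp := by
  rw [rsHeight]; positivity

/-- `K` is an additional part of the core, and `A` may be replaced by rotations anywhere. -/
theorem llEnergy_le {lam τ ε L : ℝ} (hlam : 0 < lam) (hτ : 0 < τ) (hε : 0 < ε) {Rm Rp : Mat}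
    (hm : Rm ∈ SO2) (hp : Rp ∈ SO2) (hL : ε * rsHeight τ Rm Rp < L) {A : Plane → Mat}
    (hA : ∀ x, A x = wallField (τ * ε) (ε / matNorm (Rm - Rp)) ε Rm Rp x ∨ A x ∈ SO2)
    (K : Set Plane) :
    llEnergy lam ε (square L) A
      ((wallCore (τ * ε) (ε / matNorm (Rm - Rp)) ε Rm Rp ∪ K) ∩ square L)
    ≤ ENNReal.ofReal (ε * (rsConst lam τ * L * readShockley (matNorm (Rm - Rp))))
      + volume (Metric.thickening (lam * ε) (K ∩ square L)) := by
  set θ := matNorm (Rm - Rp) with hθ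
  have hθ0 : 0 ≤ θ := matNorm_nonneg _
  have hθ4 : θ ≤ 4 := matNorm_sub_le_four hm hp
  have hmi : ∀ i, |Rp i 1 - Rm i 1| ≤ θ := fun i => by
    rw [abs_sub_comm]
    exact abs_apply_le_matNorm (Rm - Rp) i 1
  have hLi : ∀ i, ε * (τ / (2 * |Rp i 1 - Rm i 1|)) ≤ L := fun i => by
    refine le_trans (mul_le_mul_of_nonneg_left ?_ hε.le) hL.le
    have h0 : 0 ≤ τ / (2 * |Rp 0 1 - Rm 0 1|) := by positivity
    have h1 : 0 ≤ τ / (2 * |Rp 1 1 - Rm 1 1|) := by positivity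
    rw [rsHeight]
    fin_cases i
    · change τ / (2 * |Rp 0 1 - Rm 0 1|) ≤ _
      linarith
    · change τ / (2 * |Rp 1 1 - Rm 1 1|) ≤ _
      linarith
  have hL0 : 0 < L := lt_trans (mul_pos hε (rsHeight_pos hτ Rm Rp)) hL
  have hrs := readShockley_nonneg hθ0
  have hcore : coreRegion (lam * ε) (square L)
      ((wallCore (τ * ε) (ε / θ) ε Rm Rp ∪ K) ∩ square L) ⊆
      (⋃ i ∈ Finset.univ, Metric.thickening (lam * ε)
        (rowCore (τ * ε) (Rp i 1 - Rm i 1) (ε / (ε / θ + ε)) ∩ square L)) ∪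
      Metric.thickening (lam * ε) (K ∩ square L) := by
    refine inter_subset_left.trans ?_
    rw [union_inter_distrib_right, Metric.thickening_union, wallCore, iUnion_inter,
      Metric.thickening_iUnion]
    simp
  have h1 := lintegral_distSO2_le (L := L) hm hp (by positivity) hA
    (coreRegion (lam * ε) (square L) ((wallCore (τ * ε) (ε / θ) ε Rm Rp ∪ K) ∩ square L))
  have h2 := (measure_mono (μ := volume) hcore).trans ((measure_union_le _ _).trans
    (add_le_add_left (measure_biUnion_finset_le _ _) _))
  rw [llEnergy]
  refine (add_le_add h1 h2).trans ?_
  rw [← add_assoc]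
  refine add_le_add_left ?_ _
  refine (add_le_add
    (Finset.sum_le_sum fun i _ => lintegral_latticeRow_le hτ hε (hmi i) hθ4 (hLi i))
    (Finset.sum_le_sum fun i _ =>
      volume_thickening_rowCore_le hlam hτ hε (hmi i) (hLi i))).trans (le_of_eq ?_)
  rw [← ENNReal.ofReal_sum_of_nonneg (fun _ _ => by positivity),
    ← ENNReal.ofReal_sum_of_nonneg (fun _ _ => by positivity),
    ← ENNReal.ofReal_add (Finset.sum_nonneg fun _ _ => by positivity)
      (Finset.sum_nonneg fun _ _ => by positivity)]
  congr 1
  simp only [Fin.sum_univ_two, rsConst]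
  ring

theorem locIntegrable_of_bounded {A : Plane → Mat} (hA : ∀ i k, Measurable fun x => A x i k)
    (hK : ∀ i k, ∃ K, ∀ x, |A x i k| ≤ K) : LocIntegrable A := fun i k => by
  obtain ⟨K, hK⟩ := hK i k
  exact (locallyIntegrable_const K).mono (hA i k).aestronglyMeasurable
    (Eventually.of_forall fun x => (hK x).trans (le_abs_self K))

theorem integrableOn_square_of_bounded {A : Plane → Mat}
    (hA : ∀ i k, Measurable fun x => A x i k) (hK : ∀ i k, ∃ K, ∀ x, |A x i k| ≤ K) (L : ℝ)
    (i k : Fin 2) : IntegrableOn (fun x => A x i k) (square L) := by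
  obtain ⟨K, hK⟩ := hK i k
  exact Measure.integrableOn_of_bounded (volume_square_lt_top L).ne
    (hA i k).aestronglyMeasurable (Eventually.of_forall hK)

theorem fieldEnergy_le {lam τ ε : ℝ} {Ω S : Set Plane} {A : Plane → Mat}
    (h : Admissible τ ε Ω A S) :
    fieldEnergy lam τ ε Ω A ≤ llEnergy lam ε Ω A S / ENNReal.ofReal ε :=
  ENNReal.div_le_div_right (iInf₂_le S h) _

/-! ### Cutting off the field near the top and bottom of a square -/

/-- The wall field, replaced by the interface field where `|x₂| ≥ M`. -/
noncomputable def cutField (c a b M : ℝ) (Rm Rp : Mat) (x : Plane) : Mat :=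
  if M ≤ |x 1| then interfaceField Rm Rp x else wallField c a b Rm Rp x

/-- Two unbounded closed half-strips, whose interior contains every point where the cut-off changes
the field. -/
def cutCore (a M : ℝ) : Set Plane := {x | x 0 ∈ Icc (-1) (a + 1) ∧ M - 1 ≤ |x 1|}

theorem isClosed_cutCore (a M : ℝ) : IsClosed (cutCore a M) :=
  (isClosed_Icc.preimage (by fun_prop : Continuous fun x : Plane => x 0)).inter
    (isClosed_le continuous_const (by fun_prop : Continuous fun x : Plane => |x 1|))

section Cut
variable {c a b M : ℝ} {Rm Rp : Mat} {φ : Plane → ℝ}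

/-- Both half-strips are connected and unbounded, so a compactly supported function with values in
`{0, 1}` on them vanishes there. -/
theorem eq_zero_of_mem_cutCore (hφ : Continuous φ) (hφc : HasCompactSupport φ)
    (h01 : ∀ x ∈ cutCore a M, φ x = 0 ∨ φ x = 1) {x : Plane} (hx : x ∈ cutCore a M) :
    φ x = 0 := by
  obtain ⟨R, hR⟩ := exists_coord_bound hφc
  have hfar : ∀ y, R ≤ |y| → φ (ofCoords (x 0, y)) = 0 := fun y hy =>
    image_eq_zero_of_notMem_tsupport (hR _ (Or.inr hy))
  have key : ∀ J : Set ℝ, IsPreconnected J → x 1 ∈ J → (∀ y ∈ J, M - 1 ≤ |y|) →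
      (∃ y ∈ J, R ≤ |y|) → φ x = 0 := by
    rintro J hJ hxJ hJM ⟨y, hy, hyR⟩
    rw [← hfar y hyR, ← ofCoords_self x]
    exact eq_of_eq_zero_or_one (f := fun t => φ (ofCoords (x 0, t))) hJ
      (hφ.comp (continuous_ofCoords.comp (by fun_prop))).continuousOn
      (fun t ht => h01 _ ⟨hx.1, hJM t ht⟩) hxJ hy
  rcases le_abs.1 hx.2 with h | h
  · refine key (Ici (M - 1)) isPreconnected_Ici h (fun y hy => le_trans hy (le_abs_self y))
      ⟨max (M - 1) R, mem_Ici.2 (le_max_left _ _), (le_max_right _ _).trans (le_abs_self _)⟩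
  · refine key (Iic (-(M - 1))) isPreconnected_Iic (by rw [mem_Iic]; linarith)
      (fun y hy => ?_) ⟨-max (M - 1) R, mem_Iic.2 (neg_le_neg (le_max_left _ _)), ?_⟩
    · rw [mem_Iic] at hy
      linarith [neg_le_abs y]
    · rw [abs_neg]
      exact (le_max_right _ _).trans (le_abs_self _)

theorem cutField_eq_of_notMem (ha : 0 ≤ a) {x : Plane} (hx : ¬ (x 0 ∈ Ico 0 a ∧ M ≤ |x 1|)) :
    cutField c a b M Rm Rp x = wallField c a b Rm Rp x := by
  rw [cutField]
  split_ifs with h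
  · exact (wallField_eq_interfaceField ha fun h0 => hx ⟨h0, h⟩).symm
  · rfl

theorem curlPairing_cutField (ha : 0 ≤ a) (h0 : ∀ x ∈ cutCore a M, φ x = 0) :
    curlPairing univ (cutField c a b M Rm Rp) φ = curlPairing univ (wallField c a b Rm Rp) φ := by
  ext i
  rw [curlPairing, curlPairing, setIntegral_univ, setIntegral_univ]
  refine integral_congr_ae (Eventually.of_forall fun x => ?_)
  by_cases hx : x 0 ∈ Ico 0 a ∧ M ≤ |x 1|
  · have hts : x ∉ tsupport φ := by
      rw [notMem_tsupport_iff_eventuallyEq]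
      have hopen : IsOpen {y : Plane | y 0 ∈ Ioo (-1) (a + 1) ∧ M - 1 < |y 1|} :=
        (isOpen_Ioo.preimage (by fun_prop : Continuous fun y : Plane => y 0)).inter
          (isOpen_lt continuous_const (by fun_prop : Continuous fun y : Plane => |y 1|))
      filter_upwards [hopen.mem_nhds ⟨⟨by linarith [hx.1.1], by linarith [hx.1.2]⟩,
        by linarith [hx.2]⟩] with y hy
      exact h0 y ⟨Ioo_subset_Icc_self hy.1, hy.2.le⟩
    simp [Matrix.mulVec, dotProduct, Fin.sum_univ_two, gradPerp_zero, gradPerp_one,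
      partialD_eq_zero _ hts]
  · simp only [cutField_eq_of_notMem ha hx]

theorem latticeCompatible_cutField (hc : 0 < c) (ha : 0 ≤ a) (hb : 0 < b) {Ω : Set Plane}
    (hΩ : IsOpen Ω) :
    LatticeCompatible c Ω (cutField c a b M Rm Rp)
      ((wallCore c a b Rm Rp ∪ cutCore a M) ∩ Ω) := by
  refine latticeCompatible_of_pairing hΩ (isClosed_wallCore.union (isClosed_cutCore a M))
    (fun φ hφ h0 => ?_) (fun φ hφ h01 => ?_)
  · rw [curlPairing_cutField ha fun x hx => h0 x (Or.inr hx)]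
    exact curlPairing_wallField_eq_zero hc ha hb hφ.1 hφ.2.1 fun x hx => h0 x (Or.inl hx)
  · rw [curlPairing_cutField ha fun x hx =>
      eq_zero_of_mem_cutCore hφ.1.continuous hφ.2.1 (fun x hx => h01 x (Or.inr hx)) hx]
    exact exists_int_curlPairing_wallField hc ha hb hφ.1 hφ.2.1 fun x hx => h01 x (Or.inl hx)

theorem measurable_interfaceField (i k : Fin 2) :
    Measurable fun x => interfaceField Rm Rp x i k := by
  have : (fun x => interfaceField Rm Rp x i k) = fun x => if x 0 < 0 then Rm i k else Rp i k := by
    ext x; rw [interfaceField]; split_ifs <;> rfl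
  rw [this]
  exact Measurable.ite (measurableSet_lt (measurable_coord 0) measurable_const)
    measurable_const measurable_const

theorem measurable_cutField (ha : 0 ≤ a) (i k : Fin 2) :
    Measurable fun x => cutField c a b M Rm Rp x i k := by
  have : (fun x => cutField c a b M Rm Rp x i k) = fun x =>
      if M ≤ |x 1| then interfaceField Rm Rp x i k else wallField c a b Rm Rp x i k := by
    ext x; rw [cutField]; split_ifs <;> rfl
  rw [this]
  exact Measurable.ite (measurableSet_le measurable_const (measurable_coord 1).abs)
    (measurable_interfaceField i k) (measurable_wallField ha i k)

theorem abs_cutField_le (hc : 0 < c) (ha : 0 ≤ a) (hb : 0 < b) (i k : Fin 2) :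
    ∃ K, ∀ x, |cutField c a b M Rm Rp x i k| ≤ K := by
  obtain ⟨K, hK⟩ := abs_wallField_le (Rm := Rm) (Rp := Rp) hc ha hb i k
  refine ⟨|K| + |Rm i k| + |Rp i k|, fun x => ?_⟩
  have h1 := (hK x).trans (le_abs_self K)
  have h2 := abs_nonneg (Rm i k)
  have h3 := abs_nonneg (Rp i k)
  have h4 := abs_nonneg K
  rw [cutField, interfaceField]
  split_ifs <;> linarith

/-- The cost of the cut-off is independent of `L`. -/
theorem volume_thickening_cutCore_le {r L : ℝ} (hr : 0 ≤ r) (ha : 0 ≤ a) :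
    volume (Metric.thickening r (cutCore a (L - 1) ∩ square L))
      ≤ ENNReal.ofReal (2 * ((a + 2 + 2 * r) * (2 + 2 * r))) := by
  have hsub : Metric.thickening r (cutCore a (L - 1) ∩ square L) ⊆
      {x : Plane | x 0 ∈ Ioo (-1 - r) (a + 1 + r) ∧ x 1 ∈ Ioo (L - 2 - r) (L + r)} ∪
      {x : Plane | x 0 ∈ Ioo (-1 - r) (a + 1 + r) ∧ x 1 ∈ Ioo (-L - r) (-L + 2 + r)} := by
    intro x hx
    obtain ⟨z, ⟨⟨hz0, hz1⟩, hzL⟩, hxz⟩ := Metric.mem_thickening_iff.1 hx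
    have hd : ∀ i, |x i - z i| < r := fun i =>
      (PiLp.norm_apply_le (x - z) i).trans_lt (by rwa [← dist_eq_norm])
    have h0 := abs_lt.1 (hd 0)
    have h1 := abs_lt.1 (hd 1)
    have hx0 : x 0 ∈ Ioo (-1 - r) (a + 1 + r) := ⟨by linarith [hz0.1], by linarith [hz0.2]⟩
    rcases le_abs.1 hz1 with h | h
    · exact Or.inl ⟨hx0, by linarith, by linarith [(hzL 1).2]⟩
    · exact Or.inr ⟨hx0, by linarith [(hzL 1).1], by linarith⟩
  refine (measure_mono hsub).trans ((measure_union_le _ _).trans (le_of_eq ?_))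
  rw [volume_coord_box, volume_coord_box, Real.volume_Ioo, Real.volume_Ioo, Real.volume_Ioo,
    ← ENNReal.ofReal_mul (by linarith), ← ENNReal.ofReal_mul (by linarith),
    ← ENNReal.ofReal_add (mul_nonneg (by linarith) (by linarith))
      (mul_nonneg (by linarith) (by linarith))]
  congr 1
  ring

end Cut

/-! ### The Read–Shockley bounds -/

theorem psi_le {lam τ L : ℝ} (hlam : 0 < lam) (hτ : 0 < τ) {Rm Rp : Mat} (hm : Rm ∈ SO2)
    (hp : Rp ∈ SO2) (hL : rsHeight τ Rm Rp < L) (hL' : 1 / matNorm (Rm - Rp) + 1 < L) :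
    psi lam τ Rm Rp L ≤
      ENNReal.ofReal (rsConst lam τ * L * readShockley (matNorm (Rm - Rp))
        + 2 * ((1 / matNorm (Rm - Rp) + 2 + 2 * lam) * (2 + 2 * lam))) := by
  have hc : 0 < τ * 1 := by linarith
  have ha : 0 ≤ 1 / matNorm (Rm - Rp) := one_div_nonneg.2 (matNorm_nonneg _)
  set A := cutField (τ * 1) (1 / matNorm (Rm - Rp)) 1 (L - 1) Rm Rp with hA
  have hloc : LocIntegrable A :=
    locIntegrable_of_bounded (measurable_cutField ha) (abs_cutField_le hc ha one_pos)
  have hout : ∃ L' < L, ∀ x, x ∉ square L' → A x = interfaceField Rm Rp x := by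
    refine ⟨L - 1, by linarith, fun x hx => ?_⟩
    by_cases h1 : L - 1 ≤ |x 1|
    · rw [hA, cutField, if_pos h1]
    · rw [hA, cutField, if_neg h1]
      refine wallField_eq_interfaceField ha fun h0 => hx (Fin.forall_fin_two.2 ⟨?_, ?_⟩)
      · exact ⟨by linarith [h0.1], by linarith [h0.2]⟩
      · exact abs_lt.1 (not_le.1 h1)
  have hadm : Admissible τ 1 (square L) A _ :=
    ⟨integrableOn_square_of_bounded (measurable_cutField ha) (abs_cutField_le hc ha one_pos) L,
      latticeCompatible_cutField (M := L - 1) hc ha one_pos (isOpen_square L)⟩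
  have hAor : ∀ x, A x = wallField (τ * 1) (1 / matNorm (Rm - Rp)) 1 Rm Rp x ∨ A x ∈ SO2 := by
    intro x
    rw [hA, cutField]
    split_ifs
    · exact Or.inr (interfaceField_mem hm hp x)
    · exact Or.inl rfl
  refine (iInf₂_le A ⟨hloc, hout⟩).trans ((fieldEnergy_le hadm).trans ?_)
  rw [ENNReal.ofReal_one, div_one]
  refine (llEnergy_le hlam hτ one_pos hm hp (by rwa [one_mul]) hAor _).trans ?_
  have hL0 : 0 < L := (rsHeight_pos hτ Rm Rp).trans hL
  have hrs := readShockley_nonneg (matNorm_nonneg (Rm - Rp))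
  have hC := (rsConst_pos hlam hτ).le
  rw [ENNReal.ofReal_add (by positivity) (by positivity), one_mul, mul_one]
  exact add_le_add_right (volume_thickening_cutCore_le hlam.le ha) _

theorem psiInf_le {lam τ : ℝ} (hlam : 0 < lam) (hτ : 0 < τ) {Rm Rp : Mat} (hm : Rm ∈ SO2)
    (hp : Rp ∈ SO2) :
    psiInf lam τ Rm Rp ≤ ENNReal.ofReal (rsConst lam τ * readShockley (matNorm (Rm - Rp))) := by
  set B := rsConst lam τ * readShockley (matNorm (Rm - Rp)) with hB
  set K := 2 * ((1 / matNorm (Rm - Rp) + 2 + 2 * lam) * (2 + 2 * lam)) with hK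
  have hB0 : 0 ≤ B :=
    mul_nonneg (rsConst_pos hlam hτ).le (readShockley_nonneg (matNorm_nonneg _))
  have hev : ∀ᶠ L : ℝ in atTop, psi lam τ Rm Rp L / ENNReal.ofReal (2 * L)
      ≤ ENNReal.ofReal (B / 2 + K / 2 * L⁻¹) := by
    filter_upwards [eventually_gt_atTop (rsHeight τ Rm Rp),
      eventually_gt_atTop (1 / matNorm (Rm - Rp) + 1)] with L h1 h2
    have hL0 : 0 < L := (rsHeight_pos hτ Rm Rp).trans h1
    refine (ENNReal.div_le_div_right (psi_le hlam hτ hm hp h1 h2) _).trans (le_of_eq ?_)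
    rw [← ENNReal.ofReal_div_of_pos (by positivity)]
    congr 1
    rw [hB, hK]
    field_simp
  have hlim : Tendsto (fun L : ℝ => ENNReal.ofReal (B / 2 + K / 2 * L⁻¹)) atTop
      (𝓝 (ENNReal.ofReal (B / 2))) := by
    have := (tendsto_inv_atTop_zero (𝕜 := ℝ)).const_mul (K / 2) |>.const_add (B / 2)
    rw [mul_zero, add_zero] at this
    exact ENNReal.tendsto_ofReal this
  calc psiInf lam τ Rm Rp ≤ limsup (fun L : ℝ => ENNReal.ofReal (B / 2 + K / 2 * L⁻¹)) atTop :=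
        limsup_le_limsup hev
    _ = ENNReal.ofReal (B / 2) := hlim.limsup_eq
    _ ≤ ENNReal.ofReal B := ENNReal.ofReal_le_ofReal (by linarith)

end GrainBoundary

open GrainBoundary in
theorem proposition5p3 (lam τ : ℝ) (hlam : 0 < lam) (hτ : 0 < τ) :
    ∃ C : ℝ, 0 < C ∧ ∀ Rm ∈ SO2, ∀ Rp ∈ SO2,
      (∃ l h : ℝ, 0 < l ∧ 0 < h ∧ ∀ ε : ℝ, 0 < ε →
        ∃ (A : Plane → Mat) (S : Set Plane),
          LocIntegrable A ∧
          LatticeCompatible (τ * ε) univ A S ∧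
          (∀ x : Plane, x 0 ∉ Ioo (-(ε * l) / 2) (ε * l / 2) → A x = interfaceField Rm Rp x) ∧
          ∀ L : ℝ, ε * h < L →
            Admissible τ ε (square L) A (S ∩ square L) ∧
            llEnergy lam ε (square L) A (S ∩ square L) / ENNReal.ofReal ε
              ≤ ENNReal.ofReal (C * L * readShockley (matNorm (Rm - Rp))) ∧
            fieldEnergy lam τ ε (square L) A
              ≤ ENNReal.ofReal (C * L * readShockley (matNorm (Rm - Rp)))) ∧
      psiInf lam τ Rm Rp ≤ ENNReal.ofReal (C * readShockley (matNorm (Rm - Rp))) := by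
  refine ⟨rsConst lam τ, rsConst_pos hlam hτ, fun Rm hm Rp hp => ⟨?_, psiInf_le hlam hτ hm hp⟩⟩
  have hθ := matNorm_nonneg (Rm - Rp)
  -- for `Rm = Rp` the wall has width `ε / 0 = 0` and no core, and the field is constant
  refine ⟨2 * (1 / matNorm (Rm - Rp)) + 1, rsHeight τ Rm Rp, by positivity,
    rsHeight_pos hτ Rm Rp, fun ε hε => ?_⟩
  have hc : 0 < τ * ε := by positivity
  have ha : 0 ≤ ε / matNorm (Rm - Rp) := by positivity
  set A := wallField (τ * ε) (ε / matNorm (Rm - Rp)) ε Rm Rp with hA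
  refine ⟨A, wallCore (τ * ε) (ε / matNorm (Rm - Rp)) ε Rm Rp,
    locIntegrable_of_bounded (measurable_wallField ha) (abs_wallField_le hc ha hε), ?_,
    fun x hx => wallField_eq_interfaceField ha fun h0 => hx ⟨?_, ?_⟩, fun L hL => ?_⟩
  · simpa only [inter_univ] using
      latticeCompatible_wallField (Rm := Rm) (Rp := Rp) hc ha hε isOpen_univ
  · exact lt_of_lt_of_le (div_neg_of_neg_of_pos (neg_neg_of_pos (by positivity)) two_pos) h0.1
  · refine h0.2.trans ?_
    rw [div_eq_mul_one_div ε]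
    linarith
  have hadm : Admissible τ ε (square L) A
      (wallCore (τ * ε) (ε / matNorm (Rm - Rp)) ε Rm Rp ∩ square L) :=
    ⟨integrableOn_square_of_bounded (measurable_wallField ha) (abs_wallField_le hc ha hε) L,
      latticeCompatible_wallField hc ha hε (isOpen_square L)⟩
  have hE : llEnergy lam ε (square L) A
      (wallCore (τ * ε) (ε / matNorm (Rm - Rp)) ε Rm Rp ∩ square L) / ENNReal.ofReal ε
      ≤ ENNReal.ofReal (rsConst lam τ * L * readShockley (matNorm (Rm - Rp))) := by
    have h := llEnergy_le hlam hτ hε hm hp hL (A := A) (fun _ => Or.inl rfl) ∅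
    rw [union_empty, empty_inter, Metric.thickening_empty, measure_empty, add_zero,
      ENNReal.ofReal_mul hε.le] at h
    exact ENNReal.div_le_of_le_mul' h
  exact ⟨hadm, hE, (fieldEnergy_le hadm).trans hE⟩
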